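/- A \emph{curve} in $\mathbb{R}^2$ is the image of a nondegenerate interval under a continuous map; it is \emph{locally rectifiable} if it has such a parametrization with finite length on every compact subinterval. For a family $\Gamma$ of curves in $\mathbb{R}^2$ and $p \ge 1$, the $p$-modulus is $$\mathrm{mod}_p(\Gamma) = \inf_{\rho} \int_{\mathbb{R}^2} \rho(x)^p \, dx \in [0,\infty],$$ where $dx$ is Lebesgue measure and the infimum is over all Borel functions $\rho : \mathbb{R}^2 \to [0,\infty]$ such that $\int_\gamma \rho \, d\mathcal{H}^1 \ge 1$ for every locally rectifiable $\gamma \in \Gamma$ (with $\inf\emptyset=\infty$); here $\mathcal{H}^1$ is one-dimensional Hausdorff measure. \textbf{Theorem.} For every $p > 3$ there is a constant $c_p > 0$, depending only on $p$, such that the following holds. Let $\Gamma$ be a family of curves in $\mathbb{R}^2$ that contains, for every $1$-Lipschitz function $f : [0,1] \to [0,1]$, an isometric copy $\iota(G_f)$ ($\iota$ an isometry of $\mathbb{R}^2$) of the graph $$G_f = \{(x,f(x)) : x \in [0,1]\}.$$ Then $\mathrm{mod}_p(\Gamma) \ge c_p$. In particular, if $\Gamma$ is a Moser family, that is, a family of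 curves that contains an isometric copy of every rectifiable curve in $\mathbb{R}^2$ of length one (a curve with a continuous parametrization by $[0,1]$ of length one), then also $\mathrm{mod}_p(\Gamma) \ge c_p$. -/

import Mathlib

open scoped ENNReal NNReal

/-- The Euclidean plane `ℝ²`, with the Euclidean distance and Lebesgue measure `volume`. -/
abbrev Plane : Type := EuclideanSpace ℝ (Fin 2)

/-- `γ` is a curve in the plane: the image of a nondegenerate interval (open, closed or half-open,
bounded or not) under a continuous map. -/
def IsCurve (γ : Set Plane) : Prop :=
  ∃ (I : Set ℝ) (φ : ℝ → Plane), I.OrdConnected ∧ I.Nontrivial ∧ ContinuousOn φ I ∧ φ '' I = γ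

/-- `γ` is a locally rectifiable curve: it has a continuous parametrization by a nondegenerate
interval whose restriction to each compact subinterval has finite length. -/
def IsLocallyRectifiableCurve (γ : Set Plane) : Prop :=
  ∃ (I : Set ℝ) (φ : ℝ → Plane), I.OrdConnected ∧ I.Nontrivial ∧ ContinuousOn φ I ∧
    LocallyBoundedVariationOn φ I ∧ φ '' I = γ

/-- `γ` is a rectifiable curve of length one: it has a continuous parametrization by `[0,1]` whose
length (the supremum of the lengths of inscribed polygons) is `1`. -/
def IsCurveOfLengthOne (γ : Set Plane) : Prop :=
  ∃ φ : ℝ → Plane, ContinuousOn φ (Set.Icc 0 1) ∧ eVariationOn φ (Set.Icc 0 1) = 1 ∧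
    φ '' Set.Icc 0 1 = γ

/-- The family `Γ` contains an isometric copy of the set `G`. -/
def ContainsIsometricCopy (Γ : Set (Set Plane)) (G : Set Plane) : Prop :=
  ∃ ι : Plane ≃ᵢ Plane, ι '' G ∈ Γ

/-- The functions `ρ : ℝ² → [0,∞]` admissible for the family `Γ`: Borel functions whose integral
with respect to one-dimensional Hausdorff measure is at least `1` over every locally rectifiable
member of `Γ`. -/
def admissible (Γ : Set (Set Plane)) : Set (Plane → ℝ≥0∞) :=
  {ρ | Measurable ρ ∧ ∀ γ ∈ Γ, IsLocallyRectifiableCurve γ →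
    1 ≤ ∫⁻ x in γ, ρ x ∂(MeasureTheory.Measure.hausdorffMeasure 1 : MeasureTheory.Measure Plane)}

/-- The `p`-modulus of the family `Γ` with respect to Lebesgue measure. -/
noncomputable def modulus (p : ℝ) (Γ : Set (Set Plane)) : ℝ≥0∞ :=
  ⨅ ρ ∈ admissible Γ, ∫⁻ x, ρ x ^ p ∂(MeasureTheory.volume : MeasureTheory.Measure Plane)

/-- The graph `{(x, f x) : x ∈ [0,1]}`. -/
def graphOverUnitInterval (f : ℝ → ℝ) : Set Plane :=
  (fun x : ℝ => !₂[x, f x]) '' Set.Icc 0 1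

/-- A Moser family: a family of curves containing an isometric copy of every rectifiable plane
curve of length one. -/
def IsMoserFamily (Γ : Set (Set Plane)) : Prop :=
  (∀ γ ∈ Γ, IsCurve γ) ∧ ∀ γ : Set Plane, IsCurveOfLengthOne γ → ContainsIsometricCopy Γ γ

/-!
Given a density `ρ` of small `L^p` norm, the graph of small `ρ`-integral is built scale by scale.
At each scale the current graph is perturbed by a zigzag of slope at most one through independent
uniform points, so that every point of the new graph is uniformly distributed in a strip around
the old one, and the expected `ρ`-mass of the thinner new strip is its fair share of the mass of
the old strip. A Chernoff bound and a union bound over a polynomial-size net of isometries give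
this simultaneously for all congruent copies of the graph. By Hölder's inequality the cells of the
strip have mass at most a power of their size, and this power beats the logarithm in the union
bound exactly when `p > 3`. The limit graph inherits the bound by lower semicontinuity and
Fatou's lemma. To deal with isometries that move the graph far away, `ρ` is first replaced by a
lattice-periodic lower semicontinuous majorant.
-/

open MeasureTheory ProbabilityTheory Filter Finset Topology

section Concentration

variable {Ω : Type*} [MeasurableSpace Ω] {P : Measure Ω}

theorem mgf_le_exp_of_mem_Icc [IsProbabilityMeasure P] {X : Ω → ℝ} {M t : ℝ} (hX : Measurable X)
    (hXM : ∀ ω, X ω ∈ Set.Icc 0 M) (ht : 0 ≤ t) (htM : t * M ≤ 1) :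
    mgf X P t ≤ Real.exp ((1 + t * M) * t * ∫ ω, X ω ∂P) := by
  have hint : Integrable X P :=
    .of_bound hX.aestronglyMeasurable M (ae_of_all _ fun ω => by
      rw [Real.norm_of_nonneg (hXM ω).1]; exact (hXM ω).2)
  have hexp (ω : Ω) : Real.exp (t * X ω) ≤ 1 + (1 + t * M) * t * X ω := by
    have h0 : 0 ≤ t * X ω := mul_nonneg ht (hXM ω).1
    have hM : t * X ω ≤ t * M := mul_le_mul_of_nonneg_left (hXM ω).2 ht
    have := (abs_le.1 (Real.abs_exp_sub_one_sub_id_le (x := t * X ω)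
      (by rw [abs_of_nonneg h0]; linarith))).2
    nlinarith
  calc mgf X P t ≤ ∫ ω, (1 + (1 + t * M) * t * X ω) ∂P :=
        integral_mono_of_nonneg (ae_of_all _ fun ω => (Real.exp_pos _).le)
          ((integrable_const 1).add (hint.const_mul _)) (ae_of_all _ hexp)
    _ = (1 + t * M) * t * (∫ ω, X ω ∂P) + 1 := by
        rw [integral_add (integrable_const 1) (hint.const_mul _), integral_const_mul]
        simp [add_comm]
    _ ≤ _ := Real.add_one_le_exp _

theorem measureReal_mul_sum_add_log_le_sum_le {ι : Type*} {X : ι → Ω → ℝ} {M η K : ℝ}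
    (hX : ∀ i, Measurable (X i)) (hind : iIndepFun X P) (hXM : ∀ i ω, X i ω ∈ Set.Icc 0 M)
    (hM : 0 < M) (hη : 0 < η) (hη1 : η ≤ 1) (hK : 0 < K) (s : Finset ι) :
    P.real {ω | (1 + η) * ∑ i ∈ s, ∫ ω, X i ω ∂P + M / η * Real.log K ≤ ∑ i ∈ s, X i ω} ≤ K⁻¹ := by
  have := hind.isProbabilityMeasure
  have hbdd (ω : Ω) : ‖Real.exp (η / M * ∑ i ∈ s, X i ω)‖ ≤ Real.exp (η / M * ∑ _i ∈ s, M) := by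
    rw [Real.norm_of_nonneg (Real.exp_pos _).le]
    gcongr
    exact (hXM _ ω).2
  have hmgf (i : ι) : mgf (X i) P (η / M) ≤ Real.exp ((1 + η) * (η / M) * ∫ ω, X i ω ∂P) := by
    simpa only [div_mul_cancel₀ η hM.ne'] using
      mgf_le_exp_of_mem_Icc (P := P) (hX i) (hXM i) (t := η / M) (by positivity)
        (by rwa [div_mul_cancel₀ η hM.ne'])
  calc P.real {ω | (1 + η) * ∑ i ∈ s, ∫ ω, X i ω ∂P + M / η * Real.log K ≤ ∑ i ∈ s, X i ω}
      ≤ Real.exp (-(η / M) * ((1 + η) * ∑ i ∈ s, ∫ ω, X i ω ∂P + M / η * Real.log K)) *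
          mgf (fun ω => ∑ i ∈ s, X i ω) P (η / M) :=
        measure_ge_le_exp_mul_mgf _ (by positivity) (.of_bound (by fun_prop) _ (ae_of_all _ hbdd))
    _ = Real.exp (-(η / M) * ((1 + η) * ∑ i ∈ s, ∫ ω, X i ω ∂P + M / η * Real.log K)) *
          ∏ i ∈ s, mgf (X i) P (η / M) := by
        rw [← hind.mgf_sum hX s]
        congr 2
        ext ω
        simp
    _ ≤ Real.exp (-(η / M) * ((1 + η) * ∑ i ∈ s, ∫ ω, X i ω ∂P + M / η * Real.log K)) *
          ∏ i ∈ s, Real.exp ((1 + η) * (η / M) * ∫ ω, X i ω ∂P) := by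
        gcongr with i
        exacts [fun i _ => mgf_nonneg, hmgf i]
    _ = Real.exp (-Real.log K) := by
        rw [← Real.exp_sum, ← Real.exp_add, ← Finset.mul_sum]
        congr 1
        field_simp
        ring
    _ = K⁻¹ := by rw [Real.exp_neg, Real.exp_log hK]

theorem iIndepFun_curry {ι κ : Type*} {E : Type*} [MeasurableSpace E] {X : ι × κ → Ω → E}
    (hX : ∀ p, Measurable (X p)) (hind : iIndepFun X P) :
    iIndepFun (fun i ω j => X (i, j) ω) P := by
  have := hind.isProbabilityMeasure
  have hprob (p : ι × κ) : IsProbabilityMeasure (P.map (X p)) :=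
    Measure.isProbabilityMeasure_map (hX p).aemeasurable
  have hlaw (i : ι) :
      P.map (fun ω j => X (i, j) ω) = Measure.infinitePi fun j => P.map (X (i, j)) :=
    (hind.precomp (Prod.mk_right_injective i)).map_fun_eq_infinitePi_map fun j => hX (i, j)
  rw [iIndepFun_iff_map_fun_eq_infinitePi_map (by fun_prop)]
  simp_rw [hlaw]
  rw [← Measure.infinitePi_map_curry fun i j => P.map (X (i, j)),
    ← hind.map_fun_eq_infinitePi_map hX, Measure.map_map (by fun_prop) (by fun_prop)]
  rfl

variable {C : Type*} [MeasurableSpace C] (ν : Measure C) [IsProbabilityMeasure ν]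

theorem iIndepFun_infinitePi_consecutive (r : ℕ) :
    iIndepFun (fun k (θ : ℕ → C) => (θ (2 * k + r), θ (2 * k + r + 1)))
      (Measure.infinitePi fun _ => ν) := by
  have hinj : Function.Injective fun p : ℕ × Fin 2 => 2 * p.1 + r + p.2 := by
    rintro ⟨k, i⟩ ⟨l, j⟩ h
    ext <;> simp only at h ⊢ <;> omega
  have hcoord : iIndepFun (fun i (θ : ℕ → C) => θ i) (Measure.infinitePi fun _ => ν) :=
    iIndepFun_infinitePi fun _ => measurable_id
  have hblock := iIndepFun_curry (X := fun (p : ℕ × Fin 2) (θ : ℕ → C) => θ (2 * p.1 + r + p.2))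
    (fun _ => by fun_prop) (hcoord.precomp hinj)
  exact hblock.comp (fun _ b => (b 0, b 1)) fun _ => by fun_prop

theorem measurePreserving_infinitePi_consecutive (i : ℕ) :
    MeasurePreserving (fun θ : ℕ → C => (θ i, θ (i + 1))) (Measure.infinitePi fun _ => ν)
      (ν.prod ν) where
  measurable := by fun_prop
  map_eq := by
    have hcoord : iIndepFun (fun i (θ : ℕ → C) => θ i) (Measure.infinitePi fun _ => ν) :=
      iIndepFun_infinitePi fun _ => measurable_id
    have hind := hcoord.indepFun (show i ≠ i + 1 by omega)
    rw [(indepFun_iff_map_prod_eq_prod_map_map (measurable_pi_apply i).aemeasurable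
        (measurable_pi_apply (i + 1)).aemeasurable).1 hind,
      (measurePreserving_eval_infinitePi (fun _ => ν) i).map_eq,
      (measurePreserving_eval_infinitePi (fun _ => ν) (i + 1)).map_eq]

theorem measureReal_consecutive_tail_le {Y : ℕ → C × C → ℝ} {M η K : ℝ}
    (hY : ∀ i, Measurable (Y i)) (hYM : ∀ i e, Y i e ∈ Set.Icc 0 M) (hM : 0 < M) (hη : 0 < η)
    (hη1 : η ≤ 1) (hK : 0 < K) (r m : ℕ) :
    (Measure.infinitePi fun _ => ν).real {θ : ℕ → C |
      (1 + η) * ∑ k ∈ range m, ∫ e, Y (2 * k + r) e ∂(ν.prod ν) + M / η * Real.log K ≤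
        ∑ k ∈ range m, Y (2 * k + r) (θ (2 * k + r), θ (2 * k + r + 1))} ≤ K⁻¹ := by
  have hind := (iIndepFun_infinitePi_consecutive ν r).comp (fun k => Y (2 * k + r)) fun k => hY _
  have hmean (i : ℕ) : ∫ e, Y i e ∂(ν.prod ν) =
      ∫ θ : ℕ → C, Y i (θ i, θ (i + 1)) ∂(Measure.infinitePi fun _ => ν) := by
    have hp := measurePreserving_infinitePi_consecutive ν i
    rw [← hp.map_eq, integral_map hp.measurable.aemeasurable (hY i).aestronglyMeasurable]
  simp_rw [hmean]
  exact measureReal_mul_sum_add_log_le_sum_le (fun k => by have := hY (2 * k + r); fun_prop) hind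
    (fun k θ => hYM _ _) hM hη hη1 hK (range m)

theorem sum_range_eq_sum_even_add_sum_odd {A : Type*} [AddCommMonoid A] (F : ℕ → A) (n : ℕ) :
    ∑ i ∈ range n, F i =
      ∑ k ∈ range ((n + 1) / 2), F (2 * k) + ∑ k ∈ range (n / 2), F (2 * k + 1) := by
  induction n with
  | zero => simp
  | succ n ih =>
    rcases n.even_or_odd' with ⟨m, rfl | rfl⟩
    · rw [sum_range_succ, ih, show (2 * m + 1 + 1) / 2 = m + 1 by omega,
        show (2 * m + 1) / 2 = m by omega, show 2 * m / 2 = m by omega, sum_range_succ _ m]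
      abel
    · rw [sum_range_succ, ih, show (2 * m + 1 + 1 + 1) / 2 = m + 1 by omega,
        show (2 * m + 1 + 1) / 2 = m + 1 by omega, show (2 * m + 1) / 2 = m by omega,
        sum_range_succ _ m, sum_range_succ _ m, add_assoc]

theorem exists_forall_sum_consecutive_le {J : Type*} [Fintype J] {Y : J → ℕ → C × C → ℝ}
    {M η : ℝ} (hY : ∀ j i, Measurable (Y j i)) (hYM : ∀ j i e, Y j i e ∈ Set.Icc 0 M) (hM : 0 < M)
    (hη : 0 < η) (hη1 : η ≤ 1) (n : ℕ) :
    ∃ θ : ℕ → C, ∀ j, ∑ i ∈ range n, Y j i (θ i, θ (i + 1)) ≤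
      (1 + η) * ∑ i ∈ range n, ∫ e, Y j i e ∂(ν.prod ν) +
        2 * (M / η * Real.log (2 * Fintype.card J + 1)) := by
  set K : ℝ := 2 * Fintype.card J + 1 with hK
  have hK0 : 0 < K := by positivity
  let bad (r m : ℕ) (j : J) : Set (ℕ → C) := {θ |
    (1 + η) * ∑ k ∈ range m, ∫ e, Y j (2 * k + r) e ∂(ν.prod ν) + M / η * Real.log K ≤
      ∑ k ∈ range m, Y j (2 * k + r) (θ (2 * k + r), θ (2 * k + r + 1))}
  have hbad (r m : ℕ) (j : J) : (Measure.infinitePi fun _ => ν).real (bad r m j) ≤ K⁻¹ :=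
    measureReal_consecutive_tail_le ν (hY j) (hYM j) hM hη hη1 hK0 r m
  have hunion : (Measure.infinitePi fun _ => ν).real
      (⋃ j, bad 0 ((n + 1) / 2) j ∪ bad 1 (n / 2) j) < 1 := by
    calc _ ≤ ∑ _j : J, (K⁻¹ + K⁻¹) := (measureReal_iUnion_fintype_le _).trans <|
          Finset.sum_le_sum fun j _ =>
            (measureReal_union_le _ _).trans (add_le_add (hbad _ _ j) (hbad _ _ j))
      _ = (K - 1) / K := by
          rw [Finset.sum_const, nsmul_eq_mul, hK, Finset.card_univ]
          ring
      _ < 1 := by rw [div_lt_one hK0]; linarith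
  obtain ⟨θ, hθ⟩ : ∃ θ, θ ∉ ⋃ j, bad 0 ((n + 1) / 2) j ∪ bad 1 (n / 2) j := by
    by_contra! hall
    rw [Set.eq_univ_of_forall hall, probReal_univ] at hunion
    exact hunion.false
  refine ⟨θ, fun j => ?_⟩
  have hj : θ ∉ bad 0 ((n + 1) / 2) j ∪ bad 1 (n / 2) j := fun h => hθ (Set.mem_iUnion.2 ⟨j, h⟩)
  obtain ⟨heven, hodd⟩ := not_or.1 hj
  simp only [bad, Set.mem_ofPred_eq, not_le, add_zero] at heven hodd
  rw [sum_range_eq_sum_even_add_sum_odd (fun i => Y j i (θ i, θ (i + 1))),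
    sum_range_eq_sum_even_add_sum_odd (fun i => ∫ e, Y j i e ∂(ν.prod ν))]
  linarith

theorem exists_forall_sum_consecutive_le_ennreal {J : Type*} [Fintype J]
    {Y : J → ℕ → C × C → ℝ≥0∞} {M η : ℝ} (hY : ∀ j i, Measurable (Y j i))
    (hYM : ∀ j i e, Y j i e ≤ ENNReal.ofReal M) (hM : 0 < M) (hη : 0 < η) (hη1 : η ≤ 1) (n : ℕ) :
    ∃ θ : ℕ → C, ∀ j, ∑ i ∈ range n, Y j i (θ i, θ (i + 1)) ≤
      ENNReal.ofReal (1 + η) * ∑ i ∈ range n, ∫⁻ e, Y j i e ∂(ν.prod ν) +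
        ENNReal.ofReal (2 * (M / η * Real.log (2 * Fintype.card J + 1))) := by
  have hfin (j : J) (i : ℕ) (e : C × C) : Y j i e ≠ ∞ :=
    ne_top_of_le_ne_top ENNReal.ofReal_ne_top (hYM j i e)
  have hmean (j : J) (i : ℕ) : ∫⁻ e, Y j i e ∂(ν.prod ν) ≠ ∞ := by
    refine ne_top_of_le_ne_top (ENNReal.ofReal_ne_top (r := M)) ?_
    simpa using lintegral_mono (μ := ν.prod ν) (hYM j i)
  obtain ⟨θ, hθ⟩ := exists_forall_sum_consecutive_le ν (Y := fun j i e => (Y j i e).toReal)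
    (fun j i => (hY j i).ennreal_toReal)
    (fun j i e => ⟨ENNReal.toReal_nonneg, ENNReal.toReal_le_of_le_ofReal hM.le (hYM j i e)⟩)
    hM hη hη1 n
  refine ⟨θ, fun j => ?_⟩
  have hlog : 0 ≤ Real.log (2 * Fintype.card J + 1) :=
    Real.log_nonneg (le_add_of_nonneg_left (by positivity))
  have hθj := hθ j
  simp_rw [integral_toReal (hY j _).aemeasurable (ae_of_all _ fun e => (hfin j _ e).lt_top)] at hθj
  rw [← ENNReal.toReal_sum fun i _ => hfin j i _, ← ENNReal.toReal_sum fun i _ => hmean j i] at hθj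
  rw [← ENNReal.ofReal_toReal (ENNReal.sum_ne_top.2 fun i _ => hfin j i _)]
  refine (ENNReal.ofReal_le_ofReal hθj).trans_eq ?_
  rw [ENNReal.ofReal_add (by positivity) (by positivity), ENNReal.ofReal_mul (by positivity),
    ENNReal.ofReal_toReal (ENNReal.sum_ne_top.2 fun i _ => hmean j i)]

end Concentration

section CirclePath

/-- The representative in `[0, 1)` of a point of the circle: the length of the positive arc from
`0` to `c`. -/
noncomputable def circleLift (c : UnitAddCircle) : ℝ := (AddCircle.equivIco 1 0 c : ℝ)

theorem circleLift_nonneg (c : UnitAddCircle) : 0 ≤ circleLift c :=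
  (AddCircle.equivIco 1 0 c).2.1

theorem circleLift_le_one (c : UnitAddCircle) : circleLift c ≤ 1 := by
  have h : circleLift c < 0 + 1 := (AddCircle.equivIco 1 0 c).2.2
  linarith

theorem coe_circleLift (c : UnitAddCircle) : (circleLift c : UnitAddCircle) = c :=
  (AddCircle.equivIco 1 0).symm_apply_apply c

@[fun_prop]
theorem measurable_circleLift : Measurable circleLift :=
  measurable_subtype_coe.comp (AddCircle.measurableEquivIco 1 0).measurable

/-- The continuous function that vanishes before `k`, equals `1` after `k + 1` and is affine in
between. -/
noncomputable def ramp (k : ℕ) (s : ℝ) : ℝ := max 0 (min 1 (s - k))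

theorem monotone_ramp (k : ℕ) : Monotone (ramp k) := fun s t h => by
  unfold ramp
  gcongr

theorem ramp_of_le {k : ℕ} {s : ℝ} (h : s ≤ k) : ramp k s = 0 := by
  rw [ramp, min_eq_right (by linarith), max_eq_left (by linarith)]

theorem ramp_of_add_one_le {k : ℕ} {s : ℝ} (h : k + 1 ≤ s) : ramp k s = 1 := by
  rw [ramp, min_eq_left (by linarith), max_eq_right zero_le_one]

theorem ramp_of_mem_Icc {k : ℕ} {s : ℝ} (h : s ∈ Set.Icc (k : ℝ) (k + 1)) : ramp k s = s - k := by
  rw [ramp, min_eq_right (by linarith [h.2]), max_eq_right (by linarith [h.1])]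

theorem sum_range_ramp (n : ℕ) (s : ℝ) : ∑ k ∈ range n, ramp k s = max 0 (min (n : ℝ) s) := by
  induction n with
  | zero => simp
  | succ n ih =>
    rw [sum_range_succ, ih, ramp]
    have hn : (0 : ℝ) ≤ n := Nat.cast_nonneg n
    push_cast
    simp only [max_def, min_def]
    split_ifs <;> linarith

theorem sum_range_ramp_sub_le (n : ℕ) {s t : ℝ} (h : s ≤ t) :
    ∑ k ∈ range n, (ramp k t - ramp k s) ≤ t - s := by
  rw [sum_sub_distrib, sum_range_ramp, sum_range_ramp]
  have hn : (0 : ℝ) ≤ n := Nat.cast_nonneg n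
  simp only [max_def, min_def]
  split_ifs <;> linarith

/-- The path in the circle that moves from `θ k` to `θ (k + 1)` in the positive direction and at
constant speed during the time `[k, k + 1]`, for `k < n`. -/
noncomputable def circlePath (n : ℕ) (θ : ℕ → UnitAddCircle) (s : ℝ) : UnitAddCircle :=
  θ 0 + ((∑ k ∈ range n, circleLift (θ (k + 1) - θ k) * ramp k s : ℝ) : UnitAddCircle)

/-- The point that divides the positive arc from `e.1` to `e.2` in the proportion `t`. -/
noncomputable def arcPoint (t : ℝ) (e : UnitAddCircle × UnitAddCircle) : UnitAddCircle :=
  e.1 + ((t * circleLift (e.2 - e.1) : ℝ) : UnitAddCircle)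

theorem lipschitzWith_circlePath (n : ℕ) (θ : ℕ → UnitAddCircle) :
    LipschitzWith 1 (circlePath n θ) := by
  refine LipschitzWith.mk_one fun s t => ?_
  wlog h : s ≤ t generalizing s t
  · rw [dist_comm, dist_comm s]
    exact this t s (le_of_not_ge h)
  rw [dist_comm, dist_comm s, circlePath, circlePath, dist_add_left, dist_eq_norm,
    ← AddCircle.coe_sub, ← sum_sub_distrib]
  simp_rw [← mul_sub]
  have hterm (k : ℕ) : 0 ≤ ramp k t - ramp k s := sub_nonneg.2 (monotone_ramp k h)
  calc _ ≤ ‖∑ k ∈ range n, circleLift (θ (k + 1) - θ k) * (ramp k t - ramp k s)‖ :=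
        QuotientAddGroup.norm_mk_le_norm
    _ = ∑ k ∈ range n, circleLift (θ (k + 1) - θ k) * (ramp k t - ramp k s) :=
        Real.norm_of_nonneg <| Finset.sum_nonneg fun k _ =>
          mul_nonneg (circleLift_nonneg _) (hterm k)
    _ ≤ ∑ k ∈ range n, (ramp k t - ramp k s) := Finset.sum_le_sum fun k _ =>
        mul_le_of_le_one_left (hterm k) (circleLift_le_one _)
    _ ≤ t - s := sum_range_ramp_sub_le n h
    _ = dist t s := by rw [Real.dist_eq, abs_of_nonneg (sub_nonneg.2 h)]

theorem add_coe_sum_circleLift (θ : ℕ → UnitAddCircle) (k : ℕ) :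
    θ 0 + ((∑ i ∈ range k, circleLift (θ (i + 1) - θ i) : ℝ) : UnitAddCircle) = θ k := by
  induction k with
  | zero => simp
  | succ k ih =>
    rw [sum_range_succ, AddCircle.coe_add, ← add_assoc, ih, coe_circleLift]
    abel

theorem circlePath_eq_arcPoint {n k : ℕ} (θ : ℕ → UnitAddCircle) (hk : k < n) {s : ℝ}
    (hs : s ∈ Set.Icc (k : ℝ) (k + 1)) :
    circlePath n θ s = arcPoint (s - k) (θ k, θ (k + 1)) := by
  have hsum : ∑ i ∈ range n, circleLift (θ (i + 1) - θ i) * ramp i s =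
      ∑ i ∈ range k, circleLift (θ (i + 1) - θ i) +
        (s - k) * circleLift (θ (k + 1) - θ k) := by
    have hlate (i : ℕ) (hi : i ∉ range (k + 1)) : circleLift (θ (i + 1) - θ i) * ramp i s = 0 := by
      have : (k : ℝ) + 1 ≤ i := by exact_mod_cast not_lt.1 (mem_range.not.1 hi)
      rw [ramp_of_le (hs.2.trans this), mul_zero]
    have hearly (i : ℕ) (hi : i ∈ range k) :
        circleLift (θ (i + 1) - θ i) * ramp i s = circleLift (θ (i + 1) - θ i) := by
      have : (i : ℝ) + 1 ≤ k := by exact_mod_cast mem_range.1 hi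
      rw [ramp_of_add_one_le (this.trans hs.1), mul_one]
    rw [← sum_subset (range_subset_range.2 hk) fun i _ hi => hlate i hi, sum_range_succ,
      sum_congr rfl hearly, ramp_of_mem_Icc hs, mul_comm (s - k)]
  rw [circlePath, hsum, AddCircle.coe_add, ← add_assoc, add_coe_sum_circleLift, arcPoint]

@[fun_prop]
theorem measurable_arcPoint :
    Measurable fun z : ℝ × (UnitAddCircle × UnitAddCircle) => arcPoint z.1 z.2 := by
  have hlength : Measurable fun z : ℝ × (UnitAddCircle × UnitAddCircle) =>
      z.1 * circleLift (z.2.2 - z.2.1) := by fun_prop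
  exact (by fun_prop : Measurable fun z : ℝ × (UnitAddCircle × UnitAddCircle) => z.2.1).add
    (AddCircle.measurable_mk'.comp hlength)

/- Averaging first over the second endpoint replaces `e.2 - e.1` by an independent uniform point;
then the first endpoint is a uniform translation. -/
theorem lintegral_arcPoint (t : ℝ) {F : UnitAddCircle → ℝ≥0∞} (hF : Measurable F) :
    ∫⁻ e, F (arcPoint t e) ∂(volume.prod volume) = ∫⁻ x, F x := by
  have hm : Measurable fun z : UnitAddCircle × UnitAddCircle =>
      F (z.1 + ((t * circleLift z.2 : ℝ) : UnitAddCircle)) :=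
    hF.comp <| measurable_fst.add <| AddCircle.measurable_mk'.comp (by fun_prop)
  calc ∫⁻ e, F (arcPoint t e) ∂(volume.prod volume)
      = ∫⁻ x : UnitAddCircle, ∫⁻ y : UnitAddCircle, F (arcPoint t (x, y)) :=
        lintegral_prod _ (hF.comp (measurable_arcPoint.comp measurable_prodMk_left)).aemeasurable
    _ = ∫⁻ x : UnitAddCircle, ∫⁻ c, F (x + ((t * circleLift c : ℝ) : UnitAddCircle)) :=
        lintegral_congr fun x => lintegral_sub_right_eq_self
          (fun c : UnitAddCircle => F (x + ((t * circleLift c : ℝ) : UnitAddCircle))) x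
    _ = ∫⁻ c, ∫⁻ x, F (x + ((t * circleLift c : ℝ) : UnitAddCircle)) :=
        lintegral_lintegral_swap hm.aemeasurable
    _ = ∫⁻ x, F x := by
        simp_rw [lintegral_add_right_eq_self F]
        simp

theorem setLIntegral_comp_mul_add (F : ℝ → ℝ≥0∞) {b : ℝ} (hb : 0 < b) (u s t : ℝ) :
    ∫⁻ x in Set.Icc s t, F (b * x + u) =
      ENNReal.ofReal b⁻¹ * ∫⁻ w in Set.Icc (b * s + u) (b * t + u), F w := by
  have hderiv (x : ℝ) : HasDerivAt (fun x => b * x + u) b x := by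
    simpa using ((hasDerivAt_id x).const_mul b).add_const u
  rw [← Set.image_affine_Icc' hb, lintegral_image_eq_lintegral_deriv_mul_of_monotoneOn
      measurableSet_Icc (fun x _ => (hderiv x).hasDerivWithinAt)
      (fun x _ y _ hxy => by gcongr),
    lintegral_const_mul' _ _ ENNReal.ofReal_ne_top, ← mul_assoc,
    ← ENNReal.ofReal_mul (by positivity), inv_mul_cancel₀ hb.ne', ENNReal.ofReal_one, one_mul]

theorem lintegral_norm_unitAddCircle (F : ℝ → ℝ≥0∞) :
    ∫⁻ x : UnitAddCircle, F ‖x‖ = 2 * ∫⁻ s in Set.Icc 0 (1 / 2), F s := by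
  have hnorm {s : ℝ} (hs : |s| ≤ 1 / 2) : ‖(s : UnitAddCircle)‖ = |s| :=
    (AddCircle.norm_coe_eq_abs_iff 1 one_ne_zero).2 (by simpa using hs)
  have hneg : ∫⁻ s in Set.Ioc (-(1 / 2) : ℝ) 0, F ‖(s : UnitAddCircle)‖ =
      ∫⁻ s in Set.Icc 0 (1 / 2), F s := by
    have hpre : Neg.neg ⁻¹' Set.Ico (0 : ℝ) (1 / 2) = Set.Ioc (-(1 / 2)) 0 := by simp
    rw [← restrict_Ico_eq_restrict_Icc,
      ← (Measure.measurePreserving_neg (volume : Measure ℝ)).setLIntegral_comp_preimage_emb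
        (MeasurableEquiv.neg ℝ).measurableEmbedding F (Set.Ico 0 (1 / 2)), hpre]
    refine setLIntegral_congr_fun measurableSet_Ioc fun s hs => ?_
    rw [hnorm (abs_le.2 ⟨hs.1.le, by linarith [hs.2]⟩), abs_of_nonpos hs.2]
  have hpos : ∫⁻ s in Set.Ioc (0 : ℝ) (1 / 2), F ‖(s : UnitAddCircle)‖ =
      ∫⁻ s in Set.Icc 0 (1 / 2), F s := by
    rw [← restrict_Ioc_eq_restrict_Icc]
    refine setLIntegral_congr_fun measurableSet_Ioc fun s hs => ?_
    rw [hnorm (abs_le.2 ⟨by linarith [hs.1], hs.2⟩), abs_of_pos hs.1]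
  rw [← UnitAddCircle.lintegral_preimage (-(1 / 2)), show (-(1 / 2) + 1 : ℝ) = 1 / 2 by norm_num,
    ← Set.Ioc_union_Ioc_eq_Ioc (show (-(1 / 2) : ℝ) ≤ 0 by norm_num) (by norm_num),
    lintegral_union measurableSet_Ioc (Set.Ioc_disjoint_Ioc_of_le le_rfl), hneg, hpos, two_mul]

theorem lintegral_circle_translate_le {F : ℝ → ℝ≥0∞} (hF : Measurable F) {a h : ℝ} (ha : 0 < a) :
    ∫⁻ x : UnitAddCircle, ∫⁻ u in Set.Icc 0 h, F (2 * a * ‖x‖ + u) ≤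
      ENNReal.ofReal (h / a) * ∫⁻ w in Set.Icc 0 (a + h), F w := by
  have hfixed (u : ℝ) (hu : u ∈ Set.Icc 0 h) : ∫⁻ x : UnitAddCircle, F (2 * a * ‖x‖ + u) ≤
      ENNReal.ofReal a⁻¹ * ∫⁻ w in Set.Icc 0 (a + h), F w := by
    calc ∫⁻ x : UnitAddCircle, F (2 * a * ‖x‖ + u)
        = 2 * (ENNReal.ofReal (2 * a)⁻¹ *
            ∫⁻ w in Set.Icc (2 * a * 0 + u) (2 * a * (1 / 2) + u), F w) := by
          rw [lintegral_norm_unitAddCircle fun s => F (2 * a * s + u),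
            setLIntegral_comp_mul_add F (by positivity)]
      _ = ENNReal.ofReal a⁻¹ *
            ∫⁻ w in Set.Icc (2 * a * 0 + u) (2 * a * (1 / 2) + u), F w := by
          rw [← mul_assoc, ← ENNReal.ofReal_ofNat, ← ENNReal.ofReal_mul zero_le_two]
          congr 2
          field_simp
      _ ≤ _ := by
          gcongr
          · linarith [hu.1]
          · linarith
          · exact hu.2
  calc _ = ∫⁻ u in Set.Icc 0 h, ∫⁻ x : UnitAddCircle, F (2 * a * ‖x‖ + u) :=
        lintegral_lintegral_swap (by fun_prop)
    _ ≤ ∫⁻ _ in Set.Icc 0 h, ENNReal.ofReal a⁻¹ * ∫⁻ w in Set.Icc 0 (a + h), F w :=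
        setLIntegral_mono measurable_const hfixed
    _ = _ := by
        rw [setLIntegral_const, Real.volume_Icc, sub_zero, mul_right_comm,
          ← ENNReal.ofReal_mul (by positivity), div_eq_inv_mul]

end CirclePath

section GraphChart

theorem measurePreserving_isometryEquiv {E : Type*} [NormedAddCommGroup E] [InnerProductSpace ℝ E]
    [FiniteDimensional ℝ E] [MeasurableSpace E] [BorelSpace E] (ι : E ≃ᵢ E) :
    MeasurePreserving ι volume volume := by
  have hdecomp : ⇑ι = (· + ι 0) ∘ ι.toRealLinearIsometryEquiv := by
    ext x
    simp
  rw [hdecomp]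
  exact (measurePreserving_add_right volume (ι 0)).comp
    ι.toRealLinearIsometryEquiv.measurePreserving

theorem setLIntegral_le_rpow_mul {X : Type*} [MeasurableSpace X] {μ : Measure X} {F : X → ℝ≥0∞}
    (hF : Measurable F) {p : ℝ} (hp : 1 < p) (S : Set X) :
    ∫⁻ z in S, F z ∂μ ≤ (∫⁻ z in S, F z ^ p ∂μ) ^ (1 / p) * μ S ^ (1 - 1 / p) := by
  have hpq := Real.HolderConjugate.conjExponent hp
  have hq : 1 / p.conjExponent = 1 - 1 / p := by rw [one_div, one_div, ← hpq.one_sub_inv]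
  simpa only [Pi.mul_apply, mul_one, ENNReal.one_rpow, lintegral_one, Measure.restrict_apply_univ,
    hq] using ENNReal.lintegral_mul_le_Lp_mul_Lq (μ.restrict S) hpq hF.aemeasurable
      (aemeasurable_const (b := (1 : ℝ≥0∞)))

theorem abs_apply_le_norm (z : Plane) (i : Fin 2) : |z i| ≤ ‖z‖ := PiLp.norm_apply_le z i

theorem norm_le_abs_add_abs (z : Plane) : ‖z‖ ≤ |z 0| + |z 1| := by
  rw [EuclideanSpace.norm_eq, Fin.sum_univ_two]
  refine Real.sqrt_le_iff.2 ⟨by positivity, ?_⟩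
  simp only [Real.norm_eq_abs]
  nlinarith [abs_nonneg (z 0), abs_nonneg (z 1)]

/-- Coordinates around the congruent copy by `ι` of the graph of `f`: the first one runs along the
graph, the second one is the height above it. -/
noncomputable def graphChart (ι : Plane ≃ᵢ Plane) (f : ℝ → ℝ) (z : ℝ × ℝ) : Plane :=
  ι !₂[z.1, f z.1 + z.2]

/-- The inverse of `graphChart`. -/
noncomputable def graphCoord (ι : Plane ≃ᵢ Plane) (f : ℝ → ℝ) (y : Plane) : ℝ × ℝ :=
  (ι.symm y 0, ι.symm y 1 - f (ι.symm y 0))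

theorem graphCoord_graphChart (ι : Plane ≃ᵢ Plane) (f : ℝ → ℝ) (z : ℝ × ℝ) :
    graphCoord ι f (graphChart ι f z) = z := by
  simp [graphCoord, graphChart]

theorem graphChart_add (ι : Plane ≃ᵢ Plane) (f g : ℝ → ℝ) (z : ℝ × ℝ) :
    graphChart ι (f + g) z = graphChart ι f (z.1, g z.1 + z.2) := by
  simp only [graphChart, Pi.add_apply, add_assoc]

theorem measurable_graphCoord (ι : Plane ≃ᵢ Plane) {f : ℝ → ℝ} (hf : Measurable f) :
    Measurable (graphCoord ι f) := by
  have hcoord (i : Fin 2) : Measurable fun y : Plane => ι.symm y i :=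
    (EuclideanSpace.proj (𝕜 := ℝ) i).continuous.measurable.comp ι.symm.continuous.measurable
  exact (hcoord 0).prodMk ((hcoord 1).sub (hf.comp (hcoord 0)))

theorem measurePreserving_graphChart (ι : Plane ≃ᵢ Plane) {f : ℝ → ℝ} (hf : Measurable f) :
    MeasurePreserving (graphChart ι f) volume volume := by
  have hshear : MeasurePreserving (fun z : ℝ × ℝ => (z.1, f z.1 + z.2)) volume volume :=
    (MeasurePreserving.id volume).skew_product (g := fun x u => f x + u) (by fun_prop)
      (ae_of_all _ fun x => map_add_left_eq_self volume (f x))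
  exact (measurePreserving_isometryEquiv ι).comp <| (PiLp.volume_preserving_toLp (Fin 2)).comp <|
    (volume_preserving_finTwoArrow ℝ).symm.comp hshear

theorem setLIntegral_graphChart {ρ : Plane → ℝ≥0∞} (hρ : Measurable ρ) (ι : Plane ≃ᵢ Plane)
    {f : ℝ → ℝ} (hf : Measurable f) {S : Set (ℝ × ℝ)} (hS : MeasurableSet S) :
    ∫⁻ z in S, ρ (graphChart ι f z) = ∫⁻ y in graphCoord ι f ⁻¹' S, ρ y := by
  rw [← (measurePreserving_graphChart ι hf).setLIntegral_comp_preimage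
    (measurable_graphCoord ι hf hS) hρ, ← Set.preimage_comp,
    show graphCoord ι f ∘ graphChart ι f = id from funext (graphCoord_graphChart ι f),
    Set.preimage_id]

/-- The isometry `ι` sends the origin to the half-open unit square `[0, 1)²`; a lattice translation
brings every isometry to this form. -/
def IsNormalized (ι : Plane ≃ᵢ Plane) : Prop := ∀ i, ι 0 i ∈ Set.Ico (0 : ℝ) 1

theorem isNormalized_refl : IsNormalized (IsometryEquiv.refl Plane) := fun _ =>
  ⟨le_rfl, zero_lt_one⟩

theorem IsNormalized.norm_le {ι : Plane ≃ᵢ Plane} (hι : IsNormalized ι) : ‖ι 0‖ ≤ 2 := by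
  refine (norm_le_abs_add_abs _).trans ?_
  rw [abs_of_nonneg (hι 0).1, abs_of_nonneg (hι 1).1]
  linarith [(hι 0).2, (hι 1).2]

theorem IsNormalized.graphChart_mem_ball {ι : Plane ≃ᵢ Plane} (hι : IsNormalized ι) {f : ℝ → ℝ}
    (hf : ∀ x, f x ∈ Set.Icc (0 : ℝ) 1) {z : ℝ × ℝ}
    (hz : z ∈ Set.Icc (-1 : ℝ) 2 ×ˢ Set.Icc (-1 : ℝ) 2) :
    graphChart ι f z ∈ Metric.ball (0 : Plane) 10 := by
  obtain ⟨⟨hx1, hx2⟩, hu1, hu2⟩ := hz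
  set w : Plane := !₂[z.1, f z.1 + z.2] with hw
  have hw0 : |w 0| ≤ 2 := abs_le.2 ⟨by simp [w]; linarith, hx2⟩
  have hw1 : |w 1| ≤ 3 :=
    abs_le.2 ⟨by simp [w]; linarith [(hf z.1).1], by simp [w]; linarith [(hf z.1).2]⟩
  have hdist : ‖ι w - ι 0‖ = ‖w‖ := by rw [← dist_eq_norm, ι.dist_eq, dist_zero_right]
  rw [mem_ball_zero_iff, graphChart, ← hw]
  linarith [norm_le_norm_add_norm_sub' (ι w) (ι 0), norm_le_abs_add_abs w, hι.norm_le]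

theorem setLIntegral_graphChart_le_rpow {p : ℝ} (hp : 1 < p) {ρ : Plane → ℝ≥0∞}
    (hρ : Measurable ρ) (hρ1 : ∫⁻ x in Metric.ball (0 : Plane) 10, ρ x ^ p ≤ 1)
    {ι : Plane ≃ᵢ Plane} (hι : IsNormalized ι) {f : ℝ → ℝ} (hfm : Measurable f)
    (hf : ∀ x, f x ∈ Set.Icc (0 : ℝ) 1) {S : Set (ℝ × ℝ)}
    (hS : S ⊆ Set.Icc (-1 : ℝ) 2 ×ˢ Set.Icc (-1 : ℝ) 2) :
    ∫⁻ z in S, ρ (graphChart ι f z) ≤ volume S ^ (1 - 1 / p) := by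
  have hmp := measurePreserving_graphChart ι hfm
  have hball : ∫⁻ z in S, ρ (graphChart ι f z) ^ p ≤ 1 := by
    calc ∫⁻ z in S, ρ (graphChart ι f z) ^ p
        ≤ ∫⁻ z in graphChart ι f ⁻¹' Metric.ball (0 : Plane) 10, ρ (graphChart ι f z) ^ p :=
          lintegral_mono_set fun z hz => hι.graphChart_mem_ball hf (hS hz)
      _ = ∫⁻ x in Metric.ball (0 : Plane) 10, ρ x ^ p :=
          hmp.setLIntegral_comp_preimage measurableSet_ball (hρ.pow_const p)
      _ ≤ 1 := hρ1
  calc ∫⁻ z in S, ρ (graphChart ι f z)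
      ≤ (∫⁻ z in S, ρ (graphChart ι f z) ^ p) ^ (1 / p) * volume S ^ (1 - 1 / p) :=
        setLIntegral_le_rpow_mul (hρ.comp hmp.measurable) hp S
    _ ≤ 1 * volume S ^ (1 - 1 / p) := by
        gcongr
        exact ENNReal.rpow_le_one hball (by positivity)
    _ = _ := one_mul _

end GraphChart

section IsometryNet

theorem isometryEquiv_apply_eq (ι : Plane ≃ᵢ Plane) (z : Plane) :
    ι z = (1 - z 0 - z 1) • ι 0 + z 0 • ι !₂[1, 0] + z 1 • ι !₂[0, 1] := by
  have hz : z = z 0 • !₂[1, 0] + z 1 • !₂[0, 1] := by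
    ext i
    fin_cases i <;> simp
  have h := ι.toRealLinearIsometryEquiv.map_add (z 0 • !₂[1, 0]) (z 1 • !₂[0, 1])
  rw [← hz, map_smul, map_smul] at h
  simp only [IsometryEquiv.toRealLinearIsometryEquiv_apply] at h
  rw [sub_eq_iff_eq_add.1 h]
  module

/-- The three points `0`, `e₁`, `e₂`, whose images determine a plane isometry. -/
noncomputable def framePoint (k : Fin 3) : Plane := ![0, !₂[1, 0], !₂[0, 1]] k

theorem IsNormalized.framePoint_mem {ι : Plane ≃ᵢ Plane} (hι : IsNormalized ι) (k : Fin 3)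
    (i : Fin 2) : ι (framePoint k) i ∈ Set.Icc (-1 : ℝ) 2 := by
  have hnorm : ‖framePoint k‖ ≤ 1 := by
    fin_cases k <;> simp [framePoint, EuclideanSpace.norm_eq]
  have hdist : |ι (framePoint k) i - ι 0 i| ≤ 1 := by
    calc |ι (framePoint k) i - ι 0 i| ≤ ‖ι (framePoint k) - ι 0‖ :=
          abs_apply_le_norm (ι (framePoint k) - ι 0) i
      _ = ‖framePoint k‖ := by rw [← dist_eq_norm, ι.dist_eq, dist_zero_right]
      _ ≤ 1 := hnorm
  have := abs_le.1 hdist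
  exact ⟨by linarith [(hι i).1], by linarith [(hι i).2]⟩

theorem dist_le_of_framePoint {ι ι' : Plane ≃ᵢ Plane} {ε : ℝ}
    (h : ∀ k i, |ι (framePoint k) i - ι' (framePoint k) i| ≤ ε) {z : Plane}
    (h0 : |z 0| ≤ 2) (h1 : |z 1| ≤ 2) : dist (ι z) (ι' z) ≤ 18 * ε := by
  have hframe (k : Fin 3) : ‖ι (framePoint k) - ι' (framePoint k)‖ ≤ 2 * ε :=
    (norm_le_abs_add_abs _).trans <| (add_le_add (h k 0) (h k 1)).trans_eq (two_mul ε).symm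
  have hcoeff : |1 - z 0 - z 1| ≤ 5 := by
    have := abs_le.1 h0
    have := abs_le.1 h1
    exact abs_le.2 ⟨by linarith, by linarith⟩
  have hdiff : ι z - ι' z = (1 - z 0 - z 1) • (ι (framePoint 0) - ι' (framePoint 0)) +
      z 0 • (ι (framePoint 1) - ι' (framePoint 1)) +
        z 1 • (ι (framePoint 2) - ι' (framePoint 2)) := by
    rw [isometryEquiv_apply_eq ι z, isometryEquiv_apply_eq ι' z]
    simp only [framePoint, Matrix.cons_val_zero, Matrix.cons_val_one, Matrix.cons_val]
    module
  calc dist (ι z) (ι' z) ≤ |1 - z 0 - z 1| * ‖ι (framePoint 0) - ι' (framePoint 0)‖ +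
        |z 0| * ‖ι (framePoint 1) - ι' (framePoint 1)‖ +
          |z 1| * ‖ι (framePoint 2) - ι' (framePoint 2)‖ := by
        rw [dist_eq_norm, hdiff]
        exact norm_add₃_le.trans_eq (by simp only [norm_smul, Real.norm_eq_abs])
    _ ≤ 5 * (2 * ε) + 2 * (2 * ε) + 2 * (2 * ε) := by
        gcongr <;> exact hframe _
    _ = 18 * ε := by ring

theorem exists_isometry_net {n : ℕ} (hn : 0 < n) :
    ∃ net : (Fin 3 × Fin 2 → Fin (3 * n + 1)) → (Plane ≃ᵢ Plane),
      (∀ k, IsNormalized (net k)) ∧ ∀ ι, IsNormalized ι → ∃ k, ∀ z : Plane, |z 0| ≤ 2 → |z 1| ≤ 2 →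
        dist (ι z) (net k z) ≤ 18 / n := by
  have hn' : (0 : ℝ) < n := by exact_mod_cast hn
  have hnonneg {ι : Plane ≃ᵢ Plane} (hι : IsNormalized ι) (q : Fin 3 × Fin 2) :
      0 ≤ n * (ι (framePoint q.1) q.2 + 1) :=
    mul_nonneg hn'.le (by linarith [(hι.framePoint_mem q.1 q.2).1])
  let key (ι : {ι : Plane ≃ᵢ Plane // IsNormalized ι}) (q : Fin 3 × Fin 2) : Fin (3 * n + 1) :=
    ⟨⌊n * (ι.1 (framePoint q.1) q.2 + 1)⌋₊, by
      rw [Nat.floor_lt (hnonneg ι.2 q)]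
      push_cast
      nlinarith [(ι.2.framePoint_mem q.1 q.2).2]⟩
  have : Nonempty {ι : Plane ≃ᵢ Plane // IsNormalized ι} := ⟨⟨_, isNormalized_refl⟩⟩
  refine ⟨fun c => (Function.invFun key c).1, fun c => (Function.invFun key c).2, fun ι hι => ?_⟩
  set ι' := Function.invFun key (key ⟨ι, hι⟩)
  have hkey : key ι' = key ⟨ι, hι⟩ := Function.invFun_eq ⟨_, rfl⟩
  refine ⟨key ⟨ι, hι⟩, fun z h0 h1 => ?_⟩
  change dist (ι z) (ι'.1 z) ≤ _
  rw [show (18 : ℝ) / n = 18 * (1 / n) by ring]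
  refine dist_le_of_framePoint (fun k i => ?_) h0 h1
  have hfloor : ⌊n * (ι'.1 (framePoint k) i + 1)⌋₊ = ⌊n * (ι (framePoint k) i + 1)⌋₊ :=
    congrArg Fin.val (congrFun hkey (k, i))
  have hlt : |n * (ι'.1 (framePoint k) i + 1) - n * (ι (framePoint k) i + 1)| < 1 := by
    refine Int.abs_sub_lt_one_of_floor_eq_floor ?_
    rw [← Int.natCast_floor_eq_floor (hnonneg ι'.2 (k, i)),
      ← Int.natCast_floor_eq_floor (hnonneg hι (k, i)), hfloor]
  rw [← mul_sub, add_sub_add_right_eq_sub, abs_mul, abs_of_pos hn', abs_sub_comm] at hlt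
  rw [le_div_iff₀' hn']
  exact hlt.le

end IsometryNet

section Strip

/-- In the coordinates of `graphChart`, the points at heights `[0, h]` above the graph. -/
def unitStrip (h : ℝ) : Set (ℝ × ℝ) := Set.Ioc 0 1 ×ˢ Set.Icc 0 h

theorem measurableSet_unitStrip (h : ℝ) : MeasurableSet (unitStrip h) :=
  measurableSet_Ioc.prod measurableSet_Icc

theorem setLIntegral_graphChart_le_of_dist_le {ρ : Plane → ℝ≥0∞} (hρ : Measurable ρ)
    {ι ι' : Plane ≃ᵢ Plane} {f : ℝ → ℝ} (hf : LipschitzWith 1 f)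
    (hf01 : ∀ x, f x ∈ Set.Icc (0 : ℝ) 1) {h δ : ℝ} (hh1 : h ≤ 1)
    (hδ : ∀ z : Plane, |z 0| ≤ 2 → |z 1| ≤ 2 → dist (ι z) (ι' z) ≤ δ) :
    ∫⁻ z in unitStrip h, ρ (graphChart ι f z) ≤
      ∫⁻ z in Set.Icc (-(2 * δ)) (1 + 2 * δ) ×ˢ Set.Icc (-(2 * δ)) (h + 2 * δ),
        ρ (graphChart ι' f z) := by
  have hfm := hf.continuous.measurable
  rw [setLIntegral_graphChart hρ ι hfm (measurableSet_unitStrip h),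
    setLIntegral_graphChart hρ ι' hfm (measurableSet_Icc.prod measurableSet_Icc)]
  refine lintegral_mono_set fun y ⟨⟨hx0, hx1⟩, hu0, hu1⟩ => ?_
  simp only [graphCoord] at hx0 hx1 hu0 hu1
  set z := ι.symm y with hz
  set w := ι'.symm y with hw
  have hfz := hf01 (z 0)
  have hdist : ‖w - z‖ ≤ δ := by
    calc ‖w - z‖ = dist (ι z) (ι' z) := by
          rw [← dist_eq_norm, ← ι'.dist_eq, hw, hz, ι'.apply_symm_apply, ι.apply_symm_apply]
      _ ≤ δ := hδ z (abs_le.2 ⟨by linarith, by linarith⟩)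
          (abs_le.2 ⟨by linarith [hfz.1], by linarith [hfz.2]⟩)
  have hcoord (i : Fin 2) : |w i - z i| ≤ δ := (abs_apply_le_norm (w - z) i).trans hdist
  have hfdist : |f (w 0) - f (z 0)| ≤ δ := by
    have hlip := hf.dist_le_mul (w 0) (z 0)
    rw [NNReal.coe_one, one_mul, Real.dist_eq, Real.dist_eq] at hlip
    exact hlip.trans (hcoord 0)
  obtain ⟨h0, h0'⟩ := abs_le.1 (hcoord 0)
  obtain ⟨h1, h1'⟩ := abs_le.1 (hcoord 1)
  obtain ⟨h2, h2'⟩ := abs_le.1 hfdist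
  refine ⟨⟨?_, ?_⟩, ?_, ?_⟩ <;> simp only [graphCoord] <;> linarith

theorem volume_unitStrip (h : ℝ) : volume (unitStrip h) = ENNReal.ofReal h := by
  rw [unitStrip, Measure.volume_eq_prod, Measure.prod_prod, Real.volume_Ioc, Real.volume_Icc]
  simp

theorem setLIntegral_graphChart_le_add {p : ℝ} (hp : 1 < p) {ρ : Plane → ℝ≥0∞}
    (hρ : Measurable ρ) (hρ1 : ∫⁻ x in Metric.ball (0 : Plane) 10, ρ x ^ p ≤ 1)
    {ι ι' : Plane ≃ᵢ Plane} (hι' : IsNormalized ι') {f : ℝ → ℝ} (hf : LipschitzWith 1 f)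
    (hf01 : ∀ x, f x ∈ Set.Icc (0 : ℝ) 1) {h δ : ℝ} (hh : 0 ≤ h) (hh1 : h ≤ 1) (hδ0 : 0 ≤ δ)
    (hδ1 : 4 * δ ≤ 1) (hδ : ∀ z : Plane, |z 0| ≤ 2 → |z 1| ≤ 2 → dist (ι z) (ι' z) ≤ δ) :
    ∫⁻ z in unitStrip h, ρ (graphChart ι f z) ≤
      (∫⁻ z in unitStrip h, ρ (graphChart ι' f z)) + ENNReal.ofReal (12 * δ) ^ (1 - 1 / p) := by
  set T := Set.Icc (-(2 * δ)) (1 + 2 * δ) ×ˢ Set.Icc (-(2 * δ)) (h + 2 * δ) with hT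
  have hsub : unitStrip h ⊆ T := Set.prod_mono
    (fun x hx => ⟨by linarith [hx.1], by linarith [hx.2]⟩)
    (fun x hx => ⟨by linarith [hx.1], by linarith [hx.2]⟩)
  have hbig : T \ unitStrip h ⊆ Set.Icc (-1 : ℝ) 2 ×ˢ Set.Icc (-1 : ℝ) 2 :=
    Set.sdiff_subset.trans (Set.prod_mono (Set.Icc_subset_Icc (by linarith) (by linarith))
      (Set.Icc_subset_Icc (by linarith) (by linarith)))
  have hvol : volume (T \ unitStrip h) ≤ ENNReal.ofReal (12 * δ) := by
    rw [measure_sdiff hsub (measurableSet_unitStrip h).nullMeasurableSet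
        (by simp [volume_unitStrip]),
      volume_unitStrip, hT, Measure.volume_eq_prod, Measure.prod_prod, Real.volume_Icc,
      Real.volume_Icc, ← ENNReal.ofReal_mul (by linarith), ← ENNReal.ofReal_sub _ hh]
    exact ENNReal.ofReal_le_ofReal (by nlinarith)
  have hexp : 0 ≤ 1 - 1 / p := by
    rw [sub_nonneg, div_le_one (by linarith)]
    exact hp.le
  calc ∫⁻ z in unitStrip h, ρ (graphChart ι f z)
      ≤ ∫⁻ z in unitStrip h ∪ T \ unitStrip h, ρ (graphChart ι' f z) := by
        rw [Set.union_sdiff_cancel hsub]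
        exact setLIntegral_graphChart_le_of_dist_le hρ hf hf01 hh1 hδ
    _ ≤ (∫⁻ z in unitStrip h, ρ (graphChart ι' f z)) +
          ∫⁻ z in T \ unitStrip h, ρ (graphChart ι' f z) :=
        lintegral_union_le _ _ _
    _ ≤ (∫⁻ z in unitStrip h, ρ (graphChart ι' f z)) + ENNReal.ofReal (12 * δ) ^ (1 - 1 / p) := by
        gcongr
        refine (setLIntegral_graphChart_le_rpow hp hρ hρ1 hι' hf.continuous.measurable hf01
          hbig).trans ?_
        gcongr

/-- The part of the unit strip above the `i`-th of `n` intervals of equal length. -/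
def stripCell (n : ℕ) (h : ℝ) (i : ℕ) : Set (ℝ × ℝ) :=
  Set.Ioc (i / n : ℝ) ((i + 1) / n) ×ˢ Set.Icc 0 h

theorem measurableSet_stripCell (n : ℕ) (h : ℝ) (i : ℕ) : MeasurableSet (stripCell n h i) :=
  measurableSet_Ioc.prod measurableSet_Icc

theorem stripCell_subset_unitStrip {n i : ℕ} (hi : i < n) (h : ℝ) :
    stripCell n h i ⊆ unitStrip h := by
  have hn : (0 : ℝ) < n := by exact_mod_cast (Nat.zero_le i).trans_lt hi
  have hi' : (i : ℝ) + 1 ≤ n := by exact_mod_cast hi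
  exact Set.prod_mono (Set.Ioc_subset_Ioc (by positivity) ((div_le_one hn).2 hi')) le_rfl

theorem volume_stripCell (n : ℕ) (h : ℝ) (i : ℕ) :
    volume (stripCell n h i) = ENNReal.ofReal (h / n) := by
  rw [stripCell, Measure.volume_eq_prod, Measure.prod_prod, Real.volume_Ioc, Real.volume_Icc,
    ← ENNReal.ofReal_mul (by rw [← sub_div]; simp)]
  congr 1
  ring

theorem setLIntegral_unitStrip_eq_sum {n : ℕ} (hn : 0 < n) (h : ℝ) (F : ℝ × ℝ → ℝ≥0∞) :
    ∫⁻ z in unitStrip h, F z = ∑ i ∈ range n, ∫⁻ z in stripCell n h i, F z := by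
  have hn' : (0 : ℝ) < n := by exact_mod_cast hn
  have hpartial (k : ℕ) : ∫⁻ z in Set.Ioc (0 : ℝ) (k / n) ×ˢ Set.Icc 0 h, F z =
      ∑ i ∈ range k, ∫⁻ z in stripCell n h i, F z := by
    induction k with
    | zero => simp
    | succ k ih =>
      rw [sum_range_succ, ← ih, ← lintegral_union (measurableSet_stripCell n h k)
          (Set.disjoint_prod.2 (.inl (Set.Ioc_disjoint_Ioc_of_le le_rfl))), stripCell,
        ← Set.union_prod, Set.Ioc_union_Ioc_eq_Ioc (by positivity) (by gcongr; linarith),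
        Nat.cast_succ]
  simpa only [div_self hn'.ne', unitStrip] using hpartial n

end Strip

section Perturbation

/-- The tent of height at most `a` over the `i`-th of `n` intervals of equal length that is
determined by the arc with endpoints `e`. -/
noncomputable def arcTent (a : ℝ) (n i : ℕ) (e : UnitAddCircle × UnitAddCircle) (x : ℝ) : ℝ :=
  2 * a * ‖arcPoint (n * x - i) e‖

theorem measurable_arcTent (a : ℝ) (n i : ℕ) :
    Measurable fun z : (UnitAddCircle × UnitAddCircle) × ℝ => arcTent a n i z.1 z.2 :=
  ((measurable_arcPoint.comp (f := fun z : (UnitAddCircle × UnitAddCircle) × ℝ =>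
    (n * z.2 - i, z.1)) (by fun_prop)).norm).const_mul (2 * a)

theorem two_mul_mul_norm_mem_Icc {a : ℝ} (ha : 0 ≤ a) (c : UnitAddCircle) :
    2 * a * ‖c‖ ∈ Set.Icc 0 a := by
  have h : ‖c‖ ≤ 1 / 2 := by
    simpa using AddCircle.norm_le_half_period (1 : ℝ) (x := c) one_ne_zero
  exact ⟨by positivity, by nlinarith⟩

/-- The mass of `ρ` at heights `[0, h]` above one piece of the congruent copy by `ι` of the graph
of `f` raised by a tent, as a function of the endpoints of the arc defining the tent. -/
noncomputable def cellMass (ρ : Plane → ℝ≥0∞) (ι : Plane ≃ᵢ Plane) (f : ℝ → ℝ) (a h : ℝ) (n i : ℕ)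
    (e : UnitAddCircle × UnitAddCircle) : ℝ≥0∞ :=
  ∫⁻ z in stripCell n h i, ρ (graphChart ι (f + arcTent a n i e) z)

variable {ρ : Plane → ℝ≥0∞} (hρ : Measurable ρ)
include hρ

theorem measurable_cellMass_integrand (ι : Plane ≃ᵢ Plane) {f : ℝ → ℝ} (hf : Measurable f) (a : ℝ)
    (n i : ℕ) : Measurable fun z : (UnitAddCircle × UnitAddCircle) × (ℝ × ℝ) =>
      ρ (graphChart ι (f + arcTent a n i z.1) z.2) := by
  have htent : Measurable fun z : (UnitAddCircle × UnitAddCircle) × (ℝ × ℝ) =>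
      arcTent a n i z.1 z.2.1 :=
    (measurable_arcTent a n i).comp (f := fun z : (UnitAddCircle × UnitAddCircle) × (ℝ × ℝ) =>
      (z.1, z.2.1)) (by fun_prop)
  have hpoint : Measurable fun z : (UnitAddCircle × UnitAddCircle) × (ℝ × ℝ) =>
      (z.2.1, arcTent a n i z.1 z.2.1 + z.2.2) :=
    (by fun_prop)
  simp only [graphChart_add]
  exact hρ.comp ((measurePreserving_graphChart ι hf).measurable.comp hpoint)

theorem measurable_cellMass (ι : Plane ≃ᵢ Plane) {f : ℝ → ℝ} (hf : Measurable f) (a h : ℝ)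
    (n i : ℕ) : Measurable (cellMass ρ ι f a h n i) :=
  (measurable_cellMass_integrand hρ ι hf a n i).lintegral_prod_right'

theorem lintegral_arcTent_le (ι : Plane ≃ᵢ Plane) {f : ℝ → ℝ} (hf : Measurable f) {a : ℝ}
    (ha : 0 < a) (h : ℝ) (n i : ℕ) (x : ℝ) :
    ∫⁻ e, (∫⁻ u in Set.Icc 0 h, ρ (graphChart ι (f + arcTent a n i e) (x, u)))
      ∂(volume.prod volume) ≤
        ENNReal.ofReal (h / a) * ∫⁻ w in Set.Icc 0 (a + h), ρ (graphChart ι f (x, w)) := by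
  have hsection : Measurable fun w => ρ (graphChart ι f (x, w)) :=
    (hρ.comp (measurePreserving_graphChart ι hf).measurable).comp measurable_prodMk_left
  have hmass : Measurable fun c : UnitAddCircle =>
      ∫⁻ u in Set.Icc 0 h, ρ (graphChart ι f (x, 2 * a * ‖c‖ + u)) :=
    (hsection.comp (f := fun z : UnitAddCircle × ℝ => 2 * a * ‖z.1‖ + z.2)
      (by fun_prop)).lintegral_prod_right'
  simp only [graphChart_add]
  exact (lintegral_arcPoint (n * x - i) hmass).trans_le
    (lintegral_circle_translate_le hsection ha)

theorem lintegral_cellMass_le (ι : Plane ≃ᵢ Plane) {f : ℝ → ℝ} (hf : Measurable f) {a : ℝ}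
    (ha : 0 < a) (h : ℝ) (n i : ℕ) :
    ∫⁻ e, cellMass ρ ι f a h n i e ∂(volume.prod volume) ≤
      ENNReal.ofReal (h / a) * ∫⁻ z in stripCell n (a + h) i, ρ (graphChart ι f z) := by
  have hchart : Measurable fun z => ρ (graphChart ι f z) :=
    hρ.comp (measurePreserving_graphChart ι hf).measurable
  have hint := measurable_cellMass_integrand hρ ι hf a n i
  calc ∫⁻ e, cellMass ρ ι f a h n i e ∂(volume.prod volume)
      = ∫⁻ e, (∫⁻ x in Set.Ioc (i / n : ℝ) ((i + 1) / n), ∫⁻ u in Set.Icc 0 h,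
          ρ (graphChart ι (f + arcTent a n i e) (x, u))) ∂(volume.prod volume) := by
        refine lintegral_congr fun e => ?_
        exact setLIntegral_prod _ (hint.comp measurable_prodMk_left).aemeasurable
    _ = ∫⁻ x in Set.Ioc (i / n : ℝ) ((i + 1) / n), ∫⁻ e, (∫⁻ u in Set.Icc 0 h,
          ρ (graphChart ι (f + arcTent a n i e) (x, u))) ∂(volume.prod volume) := by
        refine lintegral_lintegral_swap (Measurable.aemeasurable ?_)
        exact (hint.comp (f := fun z : ((UnitAddCircle × UnitAddCircle) × ℝ) × ℝ =>
          (z.1.1, (z.1.2, z.2))) (by fun_prop)).lintegral_prod_right'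
    _ ≤ ∫⁻ x in Set.Ioc (i / n : ℝ) ((i + 1) / n), ENNReal.ofReal (h / a) *
          ∫⁻ w in Set.Icc 0 (a + h), ρ (graphChart ι f (x, w)) :=
        lintegral_mono fun x => lintegral_arcTent_le hρ ι hf ha h n i x
    _ = ENNReal.ofReal (h / a) * ∫⁻ z in stripCell n (a + h) i, ρ (graphChart ι f z) := by
        rw [lintegral_const_mul _ hchart.lintegral_prod_right', stripCell, Measure.volume_eq_prod,
          setLIntegral_prod _ hchart.aemeasurable]

theorem cellMass_le {p : ℝ} (hp : 1 < p) (hρ1 : ∫⁻ x in Metric.ball (0 : Plane) 10, ρ x ^ p ≤ 1)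
    {ι : Plane ≃ᵢ Plane} (hι : IsNormalized ι) {f : ℝ → ℝ} (hfm : Measurable f) {a h : ℝ}
    (ha : 0 ≤ a) (hf : ∀ x, f x ∈ Set.Icc (0 : ℝ) (1 - a)) (hh : 0 < h) (hh1 : h ≤ 1) {n i : ℕ}
    (hi : i < n) (e : UnitAddCircle × UnitAddCircle) :
    cellMass ρ ι f a h n i e ≤ ENNReal.ofReal ((h / n) ^ (1 - 1 / p)) := by
  have hn : (0 : ℝ) < n := by exact_mod_cast (Nat.zero_le i).trans_lt hi
  have htent : Measurable (arcTent a n i e) :=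
    (measurable_arcTent a n i).comp (f := fun x => (e, x)) (by fun_prop)
  have hmem (x : ℝ) : (f + arcTent a n i e) x ∈ Set.Icc (0 : ℝ) 1 := by
    have ht := two_mul_mul_norm_mem_Icc ha (arcPoint (n * x - i) e)
    exact ⟨add_nonneg (hf x).1 ht.1, (add_le_add (hf x).2 ht.2).trans_eq (sub_add_cancel 1 a)⟩
  have hS : stripCell n h i ⊆ Set.Icc (-1 : ℝ) 2 ×ˢ Set.Icc (-1 : ℝ) 2 :=
    (stripCell_subset_unitStrip hi h).trans <| Set.prod_mono
      (Set.Ioc_subset_Icc_self.trans (Set.Icc_subset_Icc (by norm_num) (by norm_num)))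
      (Set.Icc_subset_Icc (by norm_num) (by linarith))
  rw [← ENNReal.ofReal_rpow_of_pos (by positivity), ← volume_stripCell n h i]
  rw [cellMass]
  exact setLIntegral_graphChart_le_rpow hp hρ hρ1 hι (hfm.add htent) hmem hS

end Perturbation

section Step

theorem lipschitzWith_two_mul_norm_circlePath {a : ℝ} (ha : 0 ≤ a) (n : ℕ)
    (θ : ℕ → UnitAddCircle) :
    LipschitzWith (2 * a * n).toNNReal fun x : ℝ => 2 * a * ‖circlePath n θ (n * x)‖ := by
  refine LipschitzWith.of_dist_le_mul fun x y => ?_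
  have hnorm : |‖circlePath n θ (n * x)‖ - ‖circlePath n θ (n * y)‖| ≤ n * |x - y| := by
    calc |‖circlePath n θ (n * x)‖ - ‖circlePath n θ (n * y)‖|
        ≤ dist (circlePath n θ (n * x)) (circlePath n θ (n * y)) := by
          rw [dist_eq_norm]
          exact abs_norm_sub_norm_le _ _
      _ ≤ dist (n * x) (n * y) := by
          simpa using (lipschitzWith_circlePath n θ).dist_le_mul (n * x) (n * y)
      _ = n * |x - y| := by rw [Real.dist_eq, ← mul_sub, abs_mul, Nat.abs_cast]
  calc dist (2 * a * ‖circlePath n θ (n * x)‖) (2 * a * ‖circlePath n θ (n * y)‖)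
      = 2 * a * |‖circlePath n θ (n * x)‖ - ‖circlePath n θ (n * y)‖| := by
        rw [Real.dist_eq, ← mul_sub, abs_mul, abs_of_nonneg (by positivity : 0 ≤ 2 * a)]
    _ ≤ 2 * a * (n * |x - y|) := by gcongr
    _ = (2 * a * n).toNNReal * dist x y := by
        rw [Real.coe_toNNReal _ (by positivity), Real.dist_eq, mul_assoc (2 * a)]

variable {p : ℝ} (hp : 1 < p) {ρ : Plane → ℝ≥0∞} (hρ : Measurable ρ)
  (hρ1 : ∫⁻ x in Metric.ball (0 : Plane) 10, ρ x ^ p ≤ 1)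

theorem setLIntegral_circlePath_eq_sum (ι : Plane ≃ᵢ Plane) (f : ℝ → ℝ) (a h : ℝ) {n : ℕ}
    (hn : 0 < n) (θ : ℕ → UnitAddCircle) :
    ∫⁻ z in unitStrip h,
        ρ (graphChart ι (f + fun x => 2 * a * ‖circlePath n θ (n * x)‖) z) =
      ∑ i ∈ range n, cellMass ρ ι f a h n i (θ i, θ (i + 1)) := by
  rw [setLIntegral_unitStrip_eq_sum hn]
  refine sum_congr rfl fun i hi => setLIntegral_congr_fun (measurableSet_stripCell n h i) ?_
  rintro ⟨x, u⟩ ⟨hx, -⟩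
  have hn' : (0 : ℝ) < n := by exact_mod_cast hn
  have hmem : n * x ∈ Set.Icc (i : ℝ) (i + 1) :=
    ⟨((div_lt_iff₀' hn').1 hx.1).le, (le_div_iff₀' hn').1 hx.2⟩
  simp only [graphChart_add, arcTent, circlePath_eq_arcPoint θ (mem_range.1 hi) hmem]

include hp hρ hρ1

theorem exists_perturbation {J : Type*} [Fintype J] {net : J → (Plane ≃ᵢ Plane)}
    (hnet : ∀ j, IsNormalized (net j)) {f : ℝ → ℝ} (hfm : Measurable f) {a h η : ℝ} (ha : 0 < a)
    (hf : ∀ x, f x ∈ Set.Icc (0 : ℝ) (1 - a)) (hh : 0 < h) (hh1 : h ≤ 1) (hη : 0 < η)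
    (hη1 : η ≤ 1) {n : ℕ} (hn : 0 < n) :
    ∃ g : ℝ → ℝ, LipschitzWith (2 * a * n).toNNReal g ∧ (∀ x, g x ∈ Set.Icc 0 a) ∧
      ∀ j, ∫⁻ z in unitStrip h, ρ (graphChart (net j) (f + g) z) ≤
        ENNReal.ofReal (1 + η) *
          (ENNReal.ofReal (h / a) * ∫⁻ z in unitStrip (a + h), ρ (graphChart (net j) f z)) +
        ENNReal.ofReal (2 * ((h / n) ^ (1 - 1 / p) / η * Real.log (2 * Fintype.card J + 1))) := by
  have : IsProbabilityMeasure (volume : Measure UnitAddCircle) := ⟨by simp⟩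
  set M : ℝ := (h / n) ^ (1 - 1 / p)
  -- The cell masses are bounded by `M` only for `i < n`, hence the truncation.
  obtain ⟨θ, hθ⟩ := exists_forall_sum_consecutive_le_ennreal (volume : Measure UnitAddCircle)
    (Y := fun j i e => min (cellMass ρ (net j) f a h n i e) (ENNReal.ofReal M))
    (fun j i => (measurable_cellMass hρ _ hfm a h n i).min measurable_const)
    (fun _ _ _ => min_le_right _ _) (by positivity : 0 < M) hη hη1 n
  refine ⟨_, lipschitzWith_two_mul_norm_circlePath ha.le n θ,
    fun x => two_mul_mul_norm_mem_Icc ha.le _, fun j => ?_⟩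
  have hM (i : ℕ) (hi : i ∈ range n) : cellMass ρ (net j) f a h n i (θ i, θ (i + 1)) =
      min (cellMass ρ (net j) f a h n i (θ i, θ (i + 1))) (ENNReal.ofReal M) :=
    (min_eq_left (cellMass_le hρ hp hρ1 (hnet j) hfm ha.le hf hh hh1 (mem_range.1 hi) _)).symm
  rw [setLIntegral_circlePath_eq_sum _ f a h hn θ, sum_congr rfl hM,
    setLIntegral_unitStrip_eq_sum hn, mul_sum (a := ENNReal.ofReal (h / a))]
  refine (hθ j).trans ?_
  gcongr with i
  calc _ ≤ ∫⁻ e, cellMass ρ (net j) f a h n i e ∂(volume.prod volume) :=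
        lintegral_mono fun _ => min_le_left _ _
    _ ≤ _ := lintegral_cellMass_le hρ _ hfm ha h n i

/-- The loss in one perturbation step with `n` cells and a net of isometries of mesh `18 / N`: the
first term comes from the union bound over the net, the second one from the mesh. -/
noncomputable def stepError (p h η : ℝ) (n N : ℕ) : ℝ :=
  2 * (h / n) ^ (1 - 1 / p) / (h * η) * Real.log (2 * (3 * N + 1) ^ 6 + 1) +
    (216 / N) ^ (1 - 1 / p) / h

/-- The mean mass of `ρ` at heights `[0, h]` above any normalized congruent copy of the graph of `f`
is at most `B`. -/
def HasStripBound (ρ : Plane → ℝ≥0∞) (f : ℝ → ℝ) (h B : ℝ) : Prop :=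
  ∀ ι, IsNormalized ι → ∫⁻ z in unitStrip h, ρ (graphChart ι f z) ≤ ENNReal.ofReal (h * B)

theorem exists_hasStripBound_add {f : ℝ → ℝ} {L : ℝ≥0} (hL : LipschitzWith L f) {a h η B : ℝ}
    (ha : 0 < a) (hf : ∀ x, f x ∈ Set.Icc (0 : ℝ) (1 - a)) (hh : 0 < h) (hh1 : h ≤ 1) (hη : 0 < η)
    (hη1 : η ≤ 1) {n : ℕ} (hn : 0 < n) (hLn : L + (2 * a * n).toNNReal ≤ 1) {N : ℕ} (hN : 72 ≤ N)
    (hB : 0 ≤ B) (hfB : HasStripBound ρ f (a + h) B) :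
    ∃ g : ℝ → ℝ, LipschitzWith (2 * a * n).toNNReal g ∧ (∀ x, g x ∈ Set.Icc 0 a) ∧
      HasStripBound ρ (f + g) h ((1 + η) * ((a + h) / a) * B + stepError p h η n N) := by
  have hN72 : (72 : ℝ) ≤ N := by exact_mod_cast hN
  obtain ⟨net, hnet, hcover⟩ := exists_isometry_net (n := N) (by omega)
  obtain ⟨g, hglip, hg, hgj⟩ :=
    exists_perturbation hp hρ hρ1 hnet hL.continuous.measurable ha hf hh hh1 hη hη1 hn
  refine ⟨g, hglip, hg, fun ι hι => ?_⟩
  obtain ⟨j, hj⟩ := hcover ι hι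
  have hlip : LipschitzWith 1 (f + g) := (hL.add hglip).weaken hLn
  have hmem (x : ℝ) : (f + g) x ∈ Set.Icc (0 : ℝ) 1 := ⟨add_nonneg (hf x).1 (hg x).1,
    (add_le_add (hf x).2 (hg x).2).trans_eq (sub_add_cancel 1 a)⟩
  have hδ : 4 * (18 / (N : ℝ)) ≤ 1 := by
    rw [← mul_div_assoc, div_le_one (by linarith)]
    linarith
  have hlog : 0 ≤ Real.log (2 * (3 * N + 1) ^ 6 + 1) :=
    Real.log_nonneg (le_add_of_nonneg_left (by positivity))
  calc ∫⁻ z in unitStrip h, ρ (graphChart ι (f + g) z)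
      ≤ (∫⁻ z in unitStrip h, ρ (graphChart (net j) (f + g) z)) +
          ENNReal.ofReal (12 * (18 / N)) ^ (1 - 1 / p) :=
        setLIntegral_graphChart_le_add hp hρ hρ1 (hnet j) hlip hmem hh.le hh1 (by positivity) hδ hj
    _ ≤ ENNReal.ofReal (1 + η) * (ENNReal.ofReal (h / a) * ENNReal.ofReal ((a + h) * B)) +
          ENNReal.ofReal (2 * ((h / n) ^ (1 - 1 / p) / η * Real.log (2 * (3 * N + 1) ^ 6 + 1))) +
          ENNReal.ofReal (216 / N) ^ (1 - 1 / p) := by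
        have hcard : (Fintype.card (Fin 3 × Fin 2 → Fin (3 * N + 1)) : ℝ) = (3 * N + 1) ^ 6 := by
          simp
        have hgj := hgj j
        rw [hcard] at hgj
        rw [show 12 * (18 / (N : ℝ)) = 216 / N by ring]
        gcongr
        refine hgj.trans ?_
        gcongr
        exact hfB _ (hnet j)
    _ = _ := by
        rw [ENNReal.ofReal_rpow_of_pos (by positivity), ← ENNReal.ofReal_mul (by positivity),
          ← ENNReal.ofReal_mul (by positivity),
          ← ENNReal.ofReal_add (by positivity) (by positivity),
          ← ENNReal.ofReal_add (by positivity) (by positivity), stepError]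
        congr 1
        field_simp
        ring

end Step

section Scales

theorem eventually_log_le {d : ℕ} :
    ∀ᶠ q : ℕ in atTop, 2 * Real.log (2 * (3 * (216 * q ^ d) + 1) ^ 6 + 1) ≤ q := by
  have hlog : ∀ᶠ q : ℕ in atTop, 2 * ((6 * (d + 1) : ℕ) * Real.log q) ≤ q := by
    have hc : (0 : ℝ) < 1 / (2 * (6 * (d + 1) : ℕ)) := by positivity
    filter_upwards [(Real.isLittleO_log_id_atTop.comp_tendsto tendsto_natCast_atTop_atTop).def hc,
      eventually_ge_atTop 1] with q hq hq1
    have hq1' : (1 : ℝ) ≤ q := by exact_mod_cast hq1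
    simp only [Function.comp_apply, id, Real.norm_eq_abs, abs_of_nonneg (Real.log_nonneg hq1'),
      Nat.abs_cast] at hq
    rw [one_div_mul_eq_div, le_div_iff₀' (by positivity)] at hq
    linarith
  filter_upwards [hlog, eventually_ge_atTop 1000] with q hq hq1000
  have hq' : (1000 : ℝ) ≤ q := by exact_mod_cast hq1000
  have hqd : (1 : ℝ) ≤ q ^ d := one_le_pow₀ (by linarith)
  have hbound : (2 * (3 * (216 * q ^ d) + 1) ^ 6 + 1 : ℝ) ≤ q ^ (6 * (d + 1)) := by
    calc (2 * (3 * (216 * q ^ d) + 1) ^ 6 + 1 : ℝ)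
        ≤ 2 * (649 * q ^ d) ^ 6 + (q ^ d) ^ 6 := by
          gcongr
          · linarith
          · exact one_le_pow₀ hqd
      _ ≤ (1000 * q ^ d) ^ 6 := by
          rw [mul_pow, mul_pow]
          nlinarith [pow_pos (zero_lt_one.trans_le hqd) 6]
      _ ≤ (q * q ^ d) ^ 6 := by gcongr
      _ = q ^ (6 * (d + 1)) := by ring
  calc 2 * Real.log (2 * (3 * (216 * q ^ d) + 1) ^ 6 + 1)
      ≤ 2 * Real.log (q ^ (6 * (d + 1))) := by gcongr
    _ ≤ q := by rwa [Real.log_pow]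

theorem stepError_eq {p : ℝ} {k q : ℕ} (hk : 1 ≤ k) (hq : 0 < q) :
    stepError p (1 / q ^ (2 * k)) (1 / q) (q ^ (k - 1)) (216 * q ^ (6 * k)) =
      2 * (q : ℝ) ^ (2 * k + 1 - (3 * k - 1) * (1 - 1 / p)) *
          Real.log (2 * (3 * (216 * q ^ (6 * k)) + 1) ^ 6 + 1) +
        (q : ℝ) ^ (2 * k - 6 * k * (1 - 1 / p)) := by
  have hq' : (0 : ℝ) < q := by exact_mod_cast hq
  have hcell : (1 / q ^ (2 * k) / (q ^ (k - 1) : ℕ) : ℝ) = (q : ℝ) ^ (-(3 * k - 1) : ℝ) := by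
    rw [Real.rpow_neg hq'.le, show (3 * k - 1 : ℝ) = ((2 * k + (k - 1) : ℕ) : ℝ) by
      push_cast [hk]; ring, Real.rpow_natCast, pow_add]
    push_cast
    rw [div_div, one_div]
  have hmesh : (216 / (216 * q ^ (6 * k) : ℕ) : ℝ) = (q : ℝ) ^ (-(6 * k) : ℝ) := by
    rw [Real.rpow_neg hq'.le, show (6 * k : ℝ) = ((6 * k : ℕ) : ℝ) by push_cast; ring,
      Real.rpow_natCast]
    push_cast
    field_simp
  have hscale : (q : ℝ) ^ (2 * k) = (q : ℝ) ^ (2 * k : ℝ) := by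
    rw [← Real.rpow_natCast]; push_cast; rfl
  rw [stepError, hcell, hmesh, ← Real.rpow_mul hq'.le, ← Real.rpow_mul hq'.le]
  push_cast
  rw [hscale]
  congr 1
  · rw [one_div_mul_one_div, div_div_eq_mul_div, div_one, ← Real.rpow_add_one hq'.ne', mul_assoc 2,
      ← Real.rpow_add hq']
    ring_nf
  · rw [div_div_eq_mul_div, div_one, ← Real.rpow_add hq']
    ring_nf

theorem exists_eventually_stepError_le {p : ℝ} (hp : 3 < p) :
    ∃ k : ℕ, 2 ≤ k ∧ ∀ᶠ q : ℕ in atTop,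
      stepError p (1 / q ^ (2 * k)) (1 / q) (q ^ (k - 1)) (216 * q ^ (6 * k)) ≤ 2 / q := by
  -- The gain exponent `k * (1 - 3 / p)` beats any constant for large `k`.
  have hgain : 0 < 1 - 3 / p := by rw [sub_pos, div_lt_one (by linarith)]; exact hp
  obtain ⟨k, hk⟩ := exists_nat_ge (max 2 (4 / (1 - 3 / p)))
  have hk2 : (2 : ℝ) ≤ k := (le_max_left _ _).trans hk
  have hk4 : 4 ≤ k * (1 - 3 / p) := (div_le_iff₀ hgain).1 ((le_max_right _ _).trans hk)
  have hthree : 3 / p = 3 * (1 / p) := by ring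
  have hinv : 0 < 1 / p := by positivity
  refine ⟨k, by exact_mod_cast hk2, ?_⟩
  filter_upwards [eventually_log_le (d := 6 * k), eventually_ge_atTop 1] with q hlog hq
  have hq' : (1 : ℝ) ≤ q := by exact_mod_cast hq
  rw [stepError_eq (by exact_mod_cast (by linarith : (1 : ℝ) ≤ k)) hq]
  have hq0 : (0 : ℝ) < q := by linarith
  have hcells : (q : ℝ) ^ (2 * k + 1 - (3 * k - 1) * (1 - 1 / p)) ≤ (1 / q) * (1 / q) := by
    calc (q : ℝ) ^ (2 * k + 1 - (3 * k - 1) * (1 - 1 / p)) ≤ (q : ℝ) ^ (-2 : ℝ) := by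
          refine Real.rpow_le_rpow_of_exponent_le hq' ?_
          rw [hthree] at hk4
          linarith
      _ = (1 / q) * (1 / q) := by rw [Real.rpow_neg hq0.le, Real.rpow_two]; field_simp
  have hmesh : (q : ℝ) ^ (2 * k - 6 * k * (1 - 1 / p)) ≤ 1 / q := by
    calc (q : ℝ) ^ (2 * k - 6 * k * (1 - 1 / p)) ≤ (q : ℝ) ^ (-1 : ℝ) := by
          refine Real.rpow_le_rpow_of_exponent_le hq' ?_
          rw [hthree] at hk4
          linarith
      _ = 1 / q := by rw [Real.rpow_neg_one, one_div]
  calc _ ≤ 2 * ((1 / q) * (1 / q)) * (q / 2) + 1 / (q : ℝ) := by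
        gcongr
        · refine Real.log_nonneg (le_add_of_nonneg_left (by positivity))
        · linarith
    _ = 2 / q := by field_simp; norm_num

theorem one_add_inv_mul_div_le {q : ℝ} {k : ℕ} (hk : 2 ≤ k) (hq : 2 ≤ q) :
    (1 + 1 / q) * (1 / q ^ k / (1 / q ^ k - 1 / q ^ (2 * k))) ≤ 1 + 2 / q := by
  have hqk : q ^ 2 ≤ q ^ k := pow_le_pow_right₀ (by linarith) hk
  have hqk1 : 0 < q ^ k - 1 := by nlinarith
  have hratio : 1 / q ^ k / (1 / q ^ k - 1 / q ^ (2 * k)) = q ^ k / (q ^ k - 1) := by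
    rw [pow_mul']
    field_simp
  rw [hratio, ← mul_div_assoc, div_le_iff₀ hqk1]
  field_simp
  nlinarith

variable {p : ℝ} {ρ : Plane → ℝ≥0∞}

theorem exists_hasStripBound_sq (hp : 1 < p) (hρ : Measurable ρ)
    (hρ1 : ∫⁻ x in Metric.ball (0 : Plane) 10, ρ x ^ p ≤ 1) {k q : ℕ} (hk : 2 ≤ k) (hq : 2 ≤ q)
    (herror : stepError p (1 / q ^ (2 * k)) (1 / q) (q ^ (k - 1)) (216 * q ^ (6 * k)) ≤ 2 / q)
    {f : ℝ → ℝ} {L : ℝ≥0} (hL : LipschitzWith L f) (hLq : L + 2 / q ≤ 1)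
    (hf : ∀ x, f x ∈ Set.Icc (0 : ℝ) (1 - 1 / q ^ k)) {B : ℝ} (hB : 0 ≤ B)
    (hfB : HasStripBound ρ f (1 / q ^ k) B) :
    ∃ f' : ℝ → ℝ, LipschitzWith (L + 2 / q) f' ∧
      (∀ x, f' x ∈ Set.Icc (f x) (1 - 1 / q ^ (2 * k))) ∧
      HasStripBound ρ f' (1 / q ^ (2 * k)) ((1 + 2 / q) * B + 2 / q) := by
  have hq2 : (2 : ℝ) ≤ q := by exact_mod_cast hq
  set h : ℝ := 1 / q ^ (2 * k)
  set a : ℝ := 1 / q ^ k - h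
  have hah : a + h = 1 / q ^ k := sub_add_cancel _ _
  have hh : 0 < h := by positivity
  have hh1 : h ≤ 1 := div_le_one_of_le₀ (one_le_pow₀ (by linarith)) (by positivity)
  have ha : 0 < a :=
    sub_pos.2 (one_div_lt_one_div_of_lt (by positivity) (pow_lt_pow_right₀ (by linarith) (by lia)))
  have hslope : (2 * a * (q ^ (k - 1) : ℕ)).toNNReal ≤ 2 / q := by
    rw [Real.toNNReal_le_iff_le_coe]
    push_cast
    calc 2 * a * q ^ (k - 1) ≤ 2 * (1 / q ^ k) * q ^ (k - 1) := by
          gcongr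
          exact sub_le_self _ hh.le
      _ = 2 / q := by
          rw [← Nat.sub_add_cancel (show 1 ≤ k by lia), pow_succ, Nat.add_sub_cancel]
          field_simp
  have hcells : 72 ≤ 216 * q ^ (6 * k) := by
    have := Nat.one_le_pow (6 * k) q (by lia)
    lia
  obtain ⟨g, hg, hg_mem, hgB⟩ := exists_hasStripBound_add hp hρ hρ1 hL ha
    (fun x => ⟨(hf x).1, (hf x).2.trans (by linarith)⟩) hh hh1 (η := 1 / q) (by positivity)
    (div_le_one_of_le₀ (by linarith) (by positivity)) (n := q ^ (k - 1)) (by positivity)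
    ((add_le_add_right hslope L).trans hLq) hcells hB (by rwa [hah])
  refine ⟨f + g, (hL.add hg).weaken (by gcongr), fun x => ⟨?_, ?_⟩, fun ι hι => ?_⟩
  · exact le_add_of_nonneg_right (hg_mem x).1
  · rw [Pi.add_apply]
    linarith [(hf x).2, (hg_mem x).2]
  · refine (hgB ι hι).trans ?_
    rw [hah]
    gcongr
    exact one_add_inv_mul_div_le hk hq2

/-- The state of the construction at scale `q ^ (-k)`. Since the scale `q` is squared at every step,
the margins `4 / q` in the slope and in the mass bound pay for all later steps. -/
structure IsStage (ρ : Plane → ℝ≥0∞) (k : ℕ) (C : ℝ) (q : ℕ) (f : ℝ → ℝ) : Prop where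
  lipschitzWith : LipschitzWith (1 - 4 / q) f
  mem_Icc : ∀ x, f x ∈ Set.Icc (0 : ℝ) (1 - 1 / q ^ k)
  hasStripBound : HasStripBound ρ f (1 / q ^ k) (C / (1 + 4 / q) - 1)

variable (hp : 1 < p) (hρ : Measurable ρ) (hρ1 : ∫⁻ x in Metric.ball (0 : Plane) 10, ρ x ^ p ≤ 1)
include hp hρ hρ1

theorem IsStage.zero {q : ℕ} (hq : 0 < q) (k : ℕ) :
    IsStage ρ k ((1 + 4 / q) * (q ^ k + 1)) q 0 where
  lipschitzWith := LipschitzWith.const' 0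
  mem_Icc _ := ⟨le_rfl, sub_nonneg.2 (div_le_one_of_le₀
    (one_le_pow₀ (by exact_mod_cast hq)) (by positivity))⟩
  hasStripBound ι hι := by
    have hq1 : (1 : ℝ) ≤ q := by exact_mod_cast hq
    have hh1 : 1 / (q : ℝ) ^ k ≤ 1 := div_le_one_of_le₀ (one_le_pow₀ hq1) (by positivity)
    have hbound : 1 / (q : ℝ) ^ k * ((1 + 4 / q) * (q ^ k + 1) / (1 + 4 / q) - 1) = 1 := by
      field_simp
      ring
    rw [hbound, ENNReal.ofReal_one]
    refine (setLIntegral_graphChart_le_rpow hp hρ hρ1 hι measurable_zero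
      (fun _ => ⟨le_rfl, zero_le_one⟩) (Set.prod_mono (fun x hx => ⟨?_, ?_⟩)
        (fun u hu => ⟨?_, ?_⟩))).trans (ENNReal.rpow_le_one ?_ ?_)
    · linarith [hx.1]
    · linarith [hx.2]
    · linarith [hu.1]
    · linarith [hu.2]
    · rw [← unitStrip, volume_unitStrip]
      exact ENNReal.ofReal_le_one.2 hh1
    · exact sub_nonneg.2 (div_le_one_of_le₀ hp.le (by linarith))

theorem IsStage.exists_sq {k q : ℕ} (hk : 2 ≤ k) (hq : 4 ≤ q)
    (herror : stepError p (1 / q ^ (2 * k)) (1 / q) (q ^ (k - 1)) (216 * q ^ (6 * k)) ≤ 2 / q)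
    {C : ℝ} (hC : 2 ≤ C) {f : ℝ → ℝ} (hf : IsStage ρ k C q f) :
    ∃ f', IsStage ρ k C (q ^ 2) f' ∧ ∀ x, f x ≤ f' x := by
  have hq4 : (4 : ℝ) ≤ q := by exact_mod_cast hq
  have hq4' : (4 : ℝ≥0) ≤ q := by exact_mod_cast hq
  have hmargin : (4 : ℝ≥0) / q ≤ 1 := div_le_one_of_le₀ hq4' (by positivity)
  have hsq : (4 : ℝ≥0) / (q ^ 2 : ℕ) ≤ 2 / q := by
    rw [div_le_div_iff₀ (by positivity) (by positivity)]
    push_cast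
    nlinarith
  have hslope : (1 - 4 / q + 2 / q : ℝ≥0) + 2 / q = 1 := by
    rw [add_assoc, ← add_div, two_add_two_eq_four, tsub_add_cancel_of_le hmargin]
  have hB : 0 ≤ C / (1 + 4 / q) - 1 := by
    have : 4 / (q : ℝ) ≤ 1 := div_le_one_of_le₀ hq4 (by positivity)
    rw [sub_nonneg, le_div_iff₀ (by positivity)]
    linarith
  have hmass : (1 + 2 / q) * (C / (1 + 4 / q) - 1) + 2 / q ≤ C / (1 + 4 / (q ^ 2 : ℕ)) - 1 := by
    suffices (1 + 2 / q) * (C / (1 + 4 / q)) ≤ C / (1 + 4 / (q ^ 2 : ℕ)) by linarith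
    push_cast
    rw [← mul_div_assoc, mul_comm, mul_div_assoc, div_eq_mul_inv C]
    gcongr
    rw [div_le_iff₀ (by positivity), ← div_eq_inv_mul, le_div_iff₀ (by positivity)]
    field_simp
    nlinarith
  obtain ⟨f', hf'L, hf', hf'B⟩ := exists_hasStripBound_sq hp hρ hρ1 hk (by lia) herror
    hf.lipschitzWith (le_self_add.trans_eq hslope) hf.mem_Icc hB hf.hasStripBound
  have hpow : ((q ^ 2 : ℕ) : ℝ) ^ k = q ^ (2 * k) := by rw [pow_mul]; push_cast; rfl
  refine ⟨f', ⟨hf'L.weaken ?_, fun x => ⟨(hf.mem_Icc x).1.trans (hf' x).1, ?_⟩, fun ι hι => ?_⟩,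
    fun x => (hf' x).1⟩
  · exact le_tsub_of_add_le_right ((add_le_add_right hsq _).trans_eq hslope)
  · rw [hpow]
    exact (hf' x).2
  · rw [hpow]
    refine (hf'B ι hι).trans ?_
    gcongr

end Scales

section Limit

theorem le_liminf_average {φ : ℝ → ℝ≥0∞} {y : ℝ} (hφ : LowerSemicontinuousAt φ y) {F h : ℕ → ℝ}
    (hF : Tendsto F atTop (𝓝 y)) (hpos : ∀ j, 0 < h j) (hh : Tendsto h atTop (𝓝 0)) :
    φ y ≤ liminf (fun j => ENNReal.ofReal (h j)⁻¹ * ∫⁻ u in Set.Icc 0 (h j), φ (F j + u))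
      atTop := by
  refine le_of_forall_lt fun c hc => ?_
  obtain ⟨c', hcc', hc'⟩ := exists_between hc
  refine hcc'.trans_le (le_liminf_of_le (by isBoundedDefault) ?_)
  obtain ⟨ε, hε, hball⟩ := Metric.eventually_nhds_iff.1 (hφ c' hc')
  filter_upwards [hh.eventually_lt_const (half_pos hε), Metric.tendsto_nhds.1 hF _ (half_pos hε)]
    with j hj hFj
  rw [Real.dist_eq] at hFj
  have hle : ∀ u ∈ Set.Icc 0 (h j), c' ≤ φ (F j + u) := fun u hu => by
    refine (hball ?_).le
    rw [Real.dist_eq, abs_lt]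
    constructor <;> linarith [abs_lt.1 hFj, hu.1, hu.2]
  calc c' = ENNReal.ofReal (h j)⁻¹ * ∫⁻ _ in Set.Icc 0 (h j), c' := by
        rw [setLIntegral_const, Real.volume_Icc, sub_zero, mul_comm, mul_assoc,
          ← ENNReal.ofReal_mul (hpos j).le, mul_inv_cancel₀ (hpos j).ne', ENNReal.ofReal_one,
          mul_one]
    _ ≤ _ := by
        gcongr ENNReal.ofReal _ * ?_
        exact setLIntegral_mono' measurableSet_Icc hle

variable {ρ : Plane → ℝ≥0∞}

theorem HasStripBound.mono {f : ℝ → ℝ} {h B B' : ℝ} (hf : HasStripBound ρ f h B) (hh : 0 ≤ h)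
    (hB : B ≤ B') : HasStripBound ρ f h B' := fun ι hι =>
  (hf ι hι).trans (by gcongr)

theorem setLIntegral_graph_le_of_tendsto (hρ : LowerSemicontinuous ρ) {F : ℕ → ℝ → ℝ}
    (hFm : ∀ j, Measurable (F j)) {f : ℝ → ℝ} (hF : ∀ x, Tendsto (F · x) atTop (𝓝 (f x)))
    {h : ℕ → ℝ} (hpos : ∀ j, 0 < h j) (hh : Tendsto h atTop (𝓝 0)) {B : ℝ}
    (hB : ∀ j, HasStripBound ρ (F j) (h j) B) {ι : Plane ≃ᵢ Plane} (hι : IsNormalized ι) :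
    ∫⁻ x in Set.Ioc 0 1, ρ (ι !₂[x, f x]) ≤ ENNReal.ofReal B := by
  have hm (j : ℕ) : Measurable fun z : ℝ × ℝ => ρ (graphChart ι (F j) z) :=
    hρ.measurable.comp (measurePreserving_graphChart ι (hFm j)).measurable
  have hm' (j : ℕ) : Measurable fun x : ℝ => ∫⁻ u in Set.Icc 0 (h j), ρ (ι !₂[x, F j x + u]) :=
    (hm j).lintegral_prod_right'
  have hlsc (x : ℝ) : LowerSemicontinuous fun v : ℝ => ρ (ι !₂[x, v]) :=
    hρ.comp (f := ρ) (g := fun v : ℝ => ι !₂[x, v]) (ι.continuous.comp (by fun_prop))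
  have hmean (j : ℕ) : ∫⁻ x in Set.Ioc 0 1, ENNReal.ofReal (h j)⁻¹ *
      ∫⁻ u in Set.Icc 0 (h j), ρ (ι !₂[x, F j x + u]) ≤ ENNReal.ofReal B := by
    calc _ = ENNReal.ofReal (h j)⁻¹ * ∫⁻ z in unitStrip (h j), ρ (graphChart ι (F j) z) := by
          rw [lintegral_const_mul _ (hm' j), unitStrip, Measure.volume_eq_prod,
            setLIntegral_prod _ (hm j).aemeasurable]
          rfl
      _ ≤ ENNReal.ofReal (h j)⁻¹ * ENNReal.ofReal (h j * B) := by gcongr; exact hB j ι hι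
      _ = ENNReal.ofReal B := by
          rw [← ENNReal.ofReal_mul (inv_nonneg.2 (hpos j).le), inv_mul_cancel_left₀ (hpos j).ne']
  calc ∫⁻ x in Set.Ioc 0 1, ρ (ι !₂[x, f x])
      ≤ ∫⁻ x in Set.Ioc 0 1, liminf (fun j => ENNReal.ofReal (h j)⁻¹ *
          ∫⁻ u in Set.Icc 0 (h j), ρ (ι !₂[x, F j x + u])) atTop :=
        lintegral_mono fun x => le_liminf_average (hlsc x _) (hF x) hpos hh
    _ ≤ liminf (fun j => ∫⁻ x in Set.Ioc 0 1, ENNReal.ofReal (h j)⁻¹ *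
          ∫⁻ u in Set.Icc 0 (h j), ρ (ι !₂[x, F j x + u])) atTop :=
        lintegral_liminf_le fun j => (hm' j).const_mul _
    _ ≤ ENNReal.ofReal B := liminf_le_of_frequently_le' (Frequently.of_forall hmean)

theorem exists_seq_isStage {p : ℝ} (hp : 1 < p) (hρ : Measurable ρ)
    (hρ1 : ∫⁻ x in Metric.ball (0 : Plane) 10, ρ x ^ p ≤ 1) {k Q : ℕ} (hk : 2 ≤ k) (hQ : 4 ≤ Q)
    (herror : ∀ q : ℕ, Q ≤ q →
      stepError p (1 / q ^ (2 * k)) (1 / q) (q ^ (k - 1)) (216 * q ^ (6 * k)) ≤ 2 / q) :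
    ∃ F : ℕ → ℝ → ℝ, (∀ j, IsStage ρ k ((1 + 4 / Q) * (Q ^ k + 1)) (Q ^ 2 ^ j) (F j)) ∧
      ∀ x, Monotone (F · x) := by
  set C : ℝ := (1 + 4 / Q) * (Q ^ k + 1)
  have hC : 2 ≤ C := by
    have hQk : (1 : ℝ) ≤ Q ^ k := one_le_pow₀ (by exact_mod_cast (show 1 ≤ Q by lia))
    have hmargin : (0 : ℝ) ≤ 4 / Q := by positivity
    nlinarith
  have hstep (j : ℕ) (f : {f // IsStage ρ k C (Q ^ 2 ^ j) f}) :
      ∃ f' : {f // IsStage ρ k C (Q ^ 2 ^ (j + 1)) f}, ∀ x, f.1 x ≤ f'.1 x := by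
    have hq : Q ≤ Q ^ 2 ^ j := Nat.le_self_pow (by positivity) Q
    obtain ⟨f', hf', hle⟩ := f.2.exists_sq hp hρ hρ1 hk (hQ.trans hq) (herror _ hq) hC
    exact ⟨⟨f', by rwa [pow_succ, pow_mul]⟩, hle⟩
  choose next hnext using hstep
  have hzero : IsStage ρ k C (Q ^ 2 ^ 0) 0 := by
    rw [pow_zero, pow_one]
    exact IsStage.zero hp hρ hρ1 (by lia) k
  let G (j : ℕ) : {f // IsStage ρ k C (Q ^ 2 ^ j) f} := Nat.rec ⟨0, hzero⟩ next j
  refine ⟨fun j => (G j).1, fun j => (G j).2, fun x => monotone_nat_of_le_succ fun j => ?_⟩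
  exact hnext j (G j) x

theorem exists_graph_lintegral_le_of_lowerSemicontinuous {p : ℝ} (hp : 3 < p) :
    ∃ C : ℝ≥0, 0 < C ∧ ∀ ρ : Plane → ℝ≥0∞, LowerSemicontinuous ρ →
      ∫⁻ x in Metric.ball (0 : Plane) 10, ρ x ^ p ≤ 1 →
        ∃ f : ℝ → ℝ, LipschitzWith 1 f ∧ (∀ x, f x ∈ Set.Icc 0 1) ∧
          ∀ ι, IsNormalized ι → ∫⁻ x in Set.Ioc 0 1, ρ (ι !₂[x, f x]) ≤ C := by
  obtain ⟨k, hk, herror⟩ := exists_eventually_stepError_le hp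
  obtain ⟨Q, hQ⟩ := eventually_atTop.1 (herror.and (eventually_ge_atTop 4))
  have hQ4 : 4 ≤ Q := (hQ Q le_rfl).2
  set C : ℝ := (1 + 4 / Q) * (Q ^ k + 1)
  have hC0 : 0 < C := by positivity
  refine ⟨C.toNNReal, Real.toNNReal_pos.2 hC0, fun ρ hρ hρ1 => ?_⟩
  obtain ⟨F, hF, hmono⟩ :=
    exists_seq_isStage (by linarith) hρ.measurable hρ1 hk hQ4 fun q hq => (hQ q hq).1
  have hmem (j : ℕ) (x : ℝ) : F j x ∈ Set.Icc 0 1 :=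
    Set.Icc_subset_Icc_right (sub_le_self _ (by positivity)) ((hF j).mem_Icc x)
  have hlip (j : ℕ) : LipschitzWith 1 (F j) := (hF j).lipschitzWith.weaken tsub_le_self
  have htend (x : ℝ) : Tendsto (F · x) atTop (𝓝 (⨆ j, F j x)) :=
    tendsto_atTop_ciSup (hmono x) ⟨1, Set.forall_mem_range.2 fun j => (hmem j x).2⟩
  have hscale : Tendsto (fun j : ℕ => 1 / ((Q ^ 2 ^ j : ℕ) : ℝ) ^ k) atTop (𝓝 0) := by
    have hQj : Tendsto (fun j : ℕ => Q ^ 2 ^ j) atTop atTop :=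
      (tendsto_pow_atTop_atTop_of_one_lt (by lia)).comp
        (tendsto_pow_atTop_atTop_of_one_lt one_lt_two)
    simp only [one_div]
    exact tendsto_inv_atTop_zero.comp ((tendsto_pow_atTop (by lia)).comp
      (tendsto_natCast_atTop_atTop.comp hQj))
  refine ⟨fun x => ⨆ j, F j x, ?_, fun x => ?_, fun ι hι => ?_⟩
  · exact (isClosed_setOfPred_lipschitzWith 1).mem_of_tendsto (tendsto_pi_nhds.2 htend)
      (Eventually.of_forall hlip)
  · exact isClosed_Icc.mem_of_tendsto (htend x) (Eventually.of_forall fun j => hmem j x)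
  · refine setLIntegral_graph_le_of_tendsto hρ (fun j => (hlip j).continuous.measurable) htend
      (fun j => by positivity) hscale (fun j => ((hF j).hasStripBound.mono (by positivity) ?_)) hι
    calc C / (1 + 4 / (Q ^ 2 ^ j : ℕ)) - 1 ≤ C / (1 + 4 / (Q ^ 2 ^ j : ℕ)) :=
          sub_le_self _ zero_le_one
      _ ≤ C := div_le_self hC0.le (le_add_of_nonneg_right (by positivity))

end Limit

section Periodization

/-- The points of the integer lattice, modulo which isometries of the plane are normalized. -/
noncomputable def latticePoint (n : ℤ × ℤ) : Plane := !₂[(n.1 : ℝ), (n.2 : ℝ)]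

theorem latticePoint_add (k n : ℤ × ℤ) :
    latticePoint (k + n) = latticePoint k + latticePoint n := by
  ext i
  fin_cases i <;> simp [latticePoint]

theorem latticePoint_zero : latticePoint 0 = 0 := by
  ext i
  fin_cases i <;> simp [latticePoint]

theorem exists_isNormalized_add_latticePoint (ι : Plane ≃ᵢ Plane) :
    ∃ ι', IsNormalized ι' ∧ ∃ n, ∀ z, ι z = ι' z + latticePoint n := by
  refine ⟨ι.trans (IsometryEquiv.addRight (-latticePoint (⌊ι 0 0⌋, ⌊ι 0 1⌋))), fun i => ?_,
    (⌊ι 0 0⌋, ⌊ι 0 1⌋), fun z => by simp⟩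
  fin_cases i <;> simp [latticePoint, ← sub_eq_add_neg, Int.fract_lt_one]

theorem card_Icc_ceil_floor_le (t : ℝ) (r : ℕ) :
    (Finset.Icc ⌈t - r⌉ ⌊t + r⌋).card ≤ 2 * r + 1 := by
  have h : ((⌊t + r⌋ - ⌈t - r⌉ : ℤ) : ℝ) ≤ (2 * r : ℤ) := by
    push_cast
    linarith [Int.floor_le (t + r), Int.le_ceil (t - r)]
  rw [Int.card_Icc]
  have := Int.cast_le.1 h
  lia

theorem tsum_indicator_ball_sub_latticePoint_le (y : Plane) (r : ℕ) :
    ∑' n, (Metric.ball (0 : Plane) r).indicator (1 : Plane → ℝ≥0∞) (y - latticePoint n) ≤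
      (2 * r + 1) ^ 2 := by
  set A := Finset.Icc ⌈y 0 - r⌉ ⌊y 0 + r⌋ ×ˢ Finset.Icc ⌈y 1 - r⌉ ⌊y 1 + r⌋ with hA
  have hzero (n : ℤ × ℤ) (hn : n ∉ A) :
      (Metric.ball (0 : Plane) r).indicator (1 : Plane → ℝ≥0∞) (y - latticePoint n) = 0 := by
    refine Set.indicator_of_notMem (fun hmem => hn ?_) _
    rw [mem_ball_zero_iff] at hmem
    have h0 := abs_le.1 ((abs_apply_le_norm _ 0).trans hmem.le)
    have h1 := abs_le.1 ((abs_apply_le_norm _ 1).trans hmem.le)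
    simp only [latticePoint, PiLp.sub_apply, Matrix.cons_val_zero, Matrix.cons_val_one] at h0 h1
    rw [hA, Finset.mem_product, Finset.mem_Icc, Finset.mem_Icc]
    exact ⟨⟨Int.ceil_le.2 (by linarith), Int.le_floor.2 (by linarith)⟩,
      Int.ceil_le.2 (by linarith), Int.le_floor.2 (by linarith)⟩
  calc ∑' n, (Metric.ball (0 : Plane) r).indicator (1 : Plane → ℝ≥0∞) (y - latticePoint n)
      = ∑ n ∈ A, (Metric.ball (0 : Plane) r).indicator (1 : Plane → ℝ≥0∞) (y - latticePoint n) :=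
        tsum_eq_sum hzero
    _ ≤ ∑ _n ∈ A, (1 : ℝ≥0∞) :=
        Finset.sum_le_sum fun n _ => Set.indicator_le_self _ (1 : Plane → ℝ≥0∞) _
    _ = (A.card : ℝ≥0∞) := by simp
    _ ≤ (((2 * r + 1) * (2 * r + 1) : ℕ) : ℝ≥0∞) := by
        rw [hA, Finset.card_product]
        gcongr <;> exact card_Icc_ceil_floor_le _ r
    _ = (2 * r + 1) ^ 2 := by push_cast; ring

theorem setLIntegral_ball_tsum_latticePoint_le {σ : Plane → ℝ≥0∞} (hσ : Measurable σ) (r : ℕ) :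
    ∫⁻ x in Metric.ball (0 : Plane) r, ∑' n, σ (x + latticePoint n) ≤
      (2 * r + 1) ^ 2 * ∫⁻ x, σ x := by
  have hball : Measurable ((Metric.ball (0 : Plane) r).indicator (1 : Plane → ℝ≥0∞)) :=
    measurable_one.indicator measurableSet_ball
  have hshift (n : ℤ × ℤ) : ∫⁻ x in Metric.ball (0 : Plane) r, σ (x + latticePoint n) =
      ∫⁻ y, (Metric.ball (0 : Plane) r).indicator 1 (y - latticePoint n) * σ y := by
    rw [← lintegral_indicator measurableSet_ball, ← lintegral_add_right_eq_self
      (fun y => (Metric.ball (0 : Plane) r).indicator 1 (y - latticePoint n) * σ y)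
      (latticePoint n)]
    refine lintegral_congr fun x => ?_
    rw [add_sub_cancel_right]
    by_cases hx : x ∈ Metric.ball (0 : Plane) r <;> simp [hx, Set.indicator]
  rw [lintegral_tsum fun n => by fun_prop]
  simp_rw [hshift]
  rw [← lintegral_tsum fun n => by fun_prop, ← lintegral_const_mul _ hσ]
  refine lintegral_mono fun y => ?_
  rw [ENNReal.tsum_mul_right]
  gcongr
  exact tsum_indicator_ball_sub_latticePoint_le y r

theorem exists_periodic_majorant {p : ℝ} (hp : 0 < p) {ρ : Plane → ℝ≥0∞} (hρ : Measurable ρ)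
    {ε : ℝ≥0∞} (hε : ∫⁻ x, ρ x ^ p < ε) :
    ∃ ρ' : Plane → ℝ≥0∞, ρ ≤ ρ' ∧ LowerSemicontinuous ρ' ∧
      (∀ x n, ρ' (x + latticePoint n) = ρ' x) ∧
      ∀ r : ℕ, ∫⁻ x in Metric.ball (0 : Plane) r, ρ' x ^ p ≤ (2 * r + 1) ^ 2 * ε := by
  obtain ⟨σ, hσρ, hσ, hσint⟩ := exists_le_lowerSemicontinuous_lintegral_ge volume
    (fun x => ρ x ^ p) (hρ.pow_const p) (tsub_pos_of_lt hε).ne'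
  rw [add_tsub_cancel_of_le hε.le] at hσint
  have hpow (t : ℝ≥0∞) : (t ^ (1 / p)) ^ p = t := by
    rw [← ENNReal.rpow_mul, one_div_mul_cancel hp.ne', ENNReal.rpow_one]
  refine ⟨fun x => (∑' n, σ (x + latticePoint n)) ^ (1 / p), fun x => ?_, ?_, fun x k => ?_,
    fun r => ?_⟩
  · rw [← ENNReal.rpow_le_rpow_iff hp, hpow]
    calc ρ x ^ p ≤ σ (x + latticePoint 0) := by simpa only [latticePoint_zero, add_zero] using hσρ x
      _ ≤ ∑' n, σ (x + latticePoint n) := ENNReal.le_tsum 0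
  · have hsum : LowerSemicontinuous fun x => ∑' n, σ (x + latticePoint n) :=
      lowerSemicontinuous_tsum fun n => hσ.comp (by fun_prop)
    exact (ENNReal.continuous_rpow_const (y := 1 / p)).comp_lowerSemicontinuous hsum
      (ENNReal.monotone_rpow_of_nonneg (by positivity))
  · simp only [add_assoc, ← latticePoint_add]
    congr 1
    exact (Equiv.addLeft k).tsum_eq fun n => σ (x + latticePoint n)
  · simp_rw [hpow]
    refine (setLIntegral_ball_tsum_latticePoint_le hσ.measurable r).trans ?_
    gcongr

theorem exists_graph_lintegral_le {p : ℝ} (hp : 3 < p) :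
    ∃ C : ℝ≥0, 0 < C ∧ ∀ ρ : Plane → ℝ≥0∞, Measurable ρ → ∫⁻ x, ρ x ^ p < ((2 * 10 + 1) ^ 2)⁻¹ →
      ∃ f : ℝ → ℝ, LipschitzWith 1 f ∧ (∀ x, f x ∈ Set.Icc 0 1) ∧
        ∀ ι : Plane ≃ᵢ Plane, ∫⁻ x in Set.Ioc 0 1, ρ (ι !₂[x, f x]) ≤ C := by
  obtain ⟨C, hC, hmain⟩ := exists_graph_lintegral_le_of_lowerSemicontinuous hp
  refine ⟨C, hC, fun ρ hρ hρp => ?_⟩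
  obtain ⟨ρ', hle, hlsc, hper, hint⟩ := exists_periodic_majorant (by linarith) hρ hρp
  have hball : ∫⁻ x in Metric.ball (0 : Plane) 10, ρ' x ^ p ≤ 1 := by
    have h := hint 10
    push_cast at h
    exact h.trans_eq (ENNReal.mul_inv_cancel (by norm_num) (by finiteness))
  obtain ⟨f, hf, hf_mem, hbound⟩ := hmain ρ' hlsc hball
  refine ⟨f, hf, hf_mem, fun ι => ?_⟩
  obtain ⟨ι', hι', n, hn⟩ := exists_isNormalized_add_latticePoint ι
  refine (lintegral_mono fun x => ?_).trans (hbound ι' hι')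
  rw [← hper _ n, ← hn]
  exact hle _

theorem exists_graph_lintegral_le_of_pos {p : ℝ} (hp : 3 < p) {ε : ℝ≥0} (hε : 0 < ε) :
    ∃ c : ℝ≥0, 0 < c ∧ ∀ ρ : Plane → ℝ≥0∞, Measurable ρ → ∫⁻ x, ρ x ^ p < c →
      ∃ f : ℝ → ℝ, LipschitzWith 1 f ∧ (∀ x, f x ∈ Set.Icc 0 1) ∧
        ∀ ι : Plane ≃ᵢ Plane, ∫⁻ x in Set.Ioc 0 1, ρ (ι !₂[x, f x]) ≤ ε := by
  obtain ⟨C, hC, hmain⟩ := exists_graph_lintegral_le hp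
  set K : ℝ≥0 := C / ε
  have hK : 0 < K := div_pos hC hε
  have hK0 : (K : ℝ≥0∞) ≠ 0 := by exact_mod_cast hK.ne'
  refine ⟨(K ^ p)⁻¹ * ((2 * 10 + 1) ^ 2)⁻¹, by positivity, fun ρ hρ hρp => ?_⟩
  have hscaled : ∫⁻ x, (K * ρ x) ^ p < ((2 * 10 + 1) ^ 2)⁻¹ := by
    have hKp : ((K : ℝ≥0∞) ^ p) ≠ 0 := (ENNReal.rpow_pos (by positivity) ENNReal.coe_ne_top).ne'
    calc ∫⁻ x, (K * ρ x) ^ p = K ^ p * ∫⁻ x, ρ x ^ p := by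
          simp_rw [ENNReal.mul_rpow_of_nonneg _ _ (by linarith : 0 ≤ p)]
          exact lintegral_const_mul' _ _ (by finiteness)
      _ < K ^ p * ((K ^ p)⁻¹ * ((2 * 10 + 1) ^ 2)⁻¹ : ℝ≥0) := by
          gcongr
          finiteness
      _ = ((2 * 10 + 1) ^ 2)⁻¹ := by
          rw [ENNReal.coe_mul, ENNReal.coe_inv (by positivity), ENNReal.coe_inv (by positivity),
            ENNReal.coe_rpow_of_ne_zero hK.ne', ← mul_assoc,
            ENNReal.mul_inv_cancel hKp (by finiteness), one_mul]
          norm_num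
  obtain ⟨f, hf, hf_mem, hbound⟩ := hmain _ (hρ.const_mul _) hscaled
  refine ⟨f, hf, hf_mem, fun ι => ?_⟩
  have h := hbound ι
  rw [lintegral_const_mul' _ _ ENNReal.coe_ne_top, mul_comm,
    ← ENNReal.le_div_iff_mul_le (.inl hK0) (.inl ENNReal.coe_ne_top),
    ← ENNReal.coe_div hK.ne', div_div_cancel₀ hC.ne'] at h
  exact h

end Periodization

section Rectifiability

theorem eVariationOn_Icc_le_of_lipschitzWith {X : Type*} [PseudoEMetricSpace X] {F : ℝ → X}
    {K : ℝ≥0} (hF : LipschitzWith K F) {a b : ℝ} (hab : a ≤ b) :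
    eVariationOn F (Set.Icc a b) ≤ K * ENNReal.ofReal (b - a) := by
  have hid := (monotone_id.monotoneOn (Set.Icc a b)).eVariationOn_eq (Set.left_mem_Icc.2 hab)
    (Set.right_mem_Icc.2 hab)
  rw [Set.inter_self] at hid
  calc eVariationOn F (Set.Icc a b) ≤ K * eVariationOn id (Set.Icc a b) :=
        hF.lipschitzOnWith.comp_eVariationOn_le (Set.mapsTo_univ id _)
    _ = K * ENNReal.ofReal (b - a) := by rw [hid]; rfl

theorem lipschitzWith_variationOnFromTo {X : Type*} [PseudoEMetricSpace X] {F : ℝ → X} {K : ℝ≥0}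
    (hF : LipschitzWith K F) (a : ℝ) : LipschitzWith K (variationOnFromTo F Set.univ a) := by
  refine LipschitzWith.of_le_add_mul K fun s t => ?_
  have hadd := variationOnFromTo.add (hF.locallyBoundedVariationOn Set.univ) (Set.mem_univ a)
    (Set.mem_univ t) (Set.mem_univ s)
  rw [← hadd]
  gcongr
  rcases le_total t s with hts | hst
  · rw [variationOnFromTo.eq_of_le _ _ hts, Set.univ_inter, Real.dist_eq,
      abs_of_nonneg (sub_nonneg.2 hts)]
    refine ENNReal.toReal_le_of_le_ofReal (mul_nonneg K.coe_nonneg (sub_nonneg.2 hts)) ?_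
    rw [ENNReal.ofReal_mul K.coe_nonneg, ENNReal.ofReal_coe_nnreal]
    exact eVariationOn_Icc_le_of_lipschitzWith hF hts
  · exact (variationOnFromTo.nonpos_of_ge _ _ hst).trans (by positivity)

theorem exists_eVariationOn_Icc_eq {X : Type*} [PseudoEMetricSpace X] {F : ℝ → X} {K : ℝ≥0}
    (hF : LipschitzWith K F) {a b : ℝ} (hab : a ≤ b) {ℓ : ℝ≥0∞}
    (hℓ : ℓ ≤ eVariationOn F (Set.Icc a b)) :
    ∃ t ∈ Set.Icc a b, eVariationOn F (Set.Icc a t) = ℓ := by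
  have hfin {t : ℝ} (ht : a ≤ t) : eVariationOn F (Set.Icc a t) ≠ ∞ :=
    ne_top_of_le_ne_top (by finiteness) (eVariationOn_Icc_le_of_lipschitzWith hF ht)
  have hvar {t : ℝ} (ht : a ≤ t) :
      variationOnFromTo F Set.univ a t = (eVariationOn F (Set.Icc a t)).toReal := by
    rw [variationOnFromTo.eq_of_le _ _ ht, Set.univ_inter]
  have hmem : ℓ.toReal ∈ Set.Icc (variationOnFromTo F Set.univ a a)
      (variationOnFromTo F Set.univ a b) := by
    rw [variationOnFromTo.self, hvar hab]
    exact ⟨ENNReal.toReal_nonneg, ENNReal.toReal_mono (hfin hab) hℓ⟩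
  obtain ⟨t, ht, hvt⟩ := intermediate_value_Icc hab
    (lipschitzWith_variationOnFromTo hF a).continuous.continuousOn hmem
  refine ⟨t, ht, ?_⟩
  rwa [hvar ht.1, ENNReal.toReal_eq_toReal_iff' (hfin ht.1)
    (ne_top_of_le_ne_top (hfin hab) hℓ)] at hvt

theorem setLIntegral_hausdorffMeasure_image_le {X : Type*} [MetricSpace X] [MeasurableSpace X]
    [BorelSpace X] {F : ℝ → X} {K : ℝ≥0} (hF : LipschitzWith K F) (s : Set ℝ) {ρ : X → ℝ≥0∞}
    (hρ : Measurable ρ) :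
    ∫⁻ y in F '' s, ρ y ∂(Measure.hausdorffMeasure 1) ≤ K * ∫⁻ x in s, ρ (F x) := by
  have hFm := hF.continuous.measurable
  have hle : (Measure.hausdorffMeasure 1 : Measure X).restrict (F '' s) ≤
      (K : ℝ≥0∞) • (volume.restrict s).map F := by
    refine Measure.le_iff.2 fun B hB => ?_
    rw [Measure.restrict_apply hB, Measure.smul_apply, Measure.map_apply hFm hB,
      Measure.restrict_apply (hFm hB), smul_eq_mul, Set.inter_comm, ← Set.image_inter_preimage,
      Set.inter_comm]
    simpa only [hausdorffMeasure_real, ENNReal.rpow_one] using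
      hF.hausdorffMeasure_image_le (d := 1) zero_le_one (F ⁻¹' B ∩ s)
  calc _ ≤ ∫⁻ y, ρ y ∂((K : ℝ≥0∞) • (volume.restrict s).map F) := lintegral_mono' hle le_rfl
    _ = _ := by rw [lintegral_smul_measure, lintegral_map hρ hFm, smul_eq_mul]

theorem IsLocallyRectifiableCurve.image {γ : Set Plane} (hγ : IsLocallyRectifiableCurve γ)
    {g : Plane → Plane} {K : ℝ≥0} (hg : LipschitzWith K g) :
    IsLocallyRectifiableCurve (g '' γ) := by
  obtain ⟨I, φ, hI, hI', hφ, hφ', rfl⟩ := hγ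
  exact ⟨I, g ∘ φ, hI, hI', hg.continuous.comp_continuousOn hφ,
    hg.comp_locallyBoundedVariationOn hφ', Set.image_comp ..⟩

theorem IsCurveOfLengthOne.isLocallyRectifiableCurve {γ : Set Plane} (hγ : IsCurveOfLengthOne γ) :
    IsLocallyRectifiableCurve γ := by
  obtain ⟨φ, hφ, hlength, rfl⟩ := hγ
  have hbdd : BoundedVariationOn φ (Set.Icc 0 1) := hlength.trans_ne ENNReal.one_ne_top
  exact ⟨_, φ, Set.ordConnected_Icc, ⟨0, by simp, 1, by simp, zero_ne_one⟩, hφ,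
    hbdd.locallyBoundedVariationOn, rfl⟩

variable {f : ℝ → ℝ} (hf : LipschitzWith 1 f)
include hf

theorem lipschitzWith_graph : LipschitzWith 2 fun x => (!₂[x, f x] : Plane) := by
  refine LipschitzWith.of_dist_le_mul fun x y => ?_
  have h := hf.dist_le_mul x y
  rw [NNReal.coe_one, one_mul, Real.dist_eq, Real.dist_eq] at h
  calc dist (!₂[x, f x] : Plane) !₂[y, f y] ≤ |x - y| + |f x - f y| := by
        rw [dist_eq_norm]
        exact norm_le_abs_add_abs _
    _ ≤ (2 : ℝ≥0) * dist x y := by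
        rw [Real.dist_eq, NNReal.coe_ofNat]
        linarith

theorem isLocallyRectifiableCurve_graph : IsLocallyRectifiableCurve (graphOverUnitInterval f) :=
  ⟨_, _, Set.ordConnected_Icc, ⟨0, by simp, 1, by simp, zero_ne_one⟩,
    (lipschitzWith_graph hf).continuous.continuousOn,
    (lipschitzWith_graph hf).locallyBoundedVariationOn _, rfl⟩

theorem exists_isCurveOfLengthOne_subset_graph :
    ∃ γ ⊆ graphOverUnitInterval f, IsCurveOfLengthOne γ := by
  have hF := lipschitzWith_graph hf
  have hlength : 1 ≤ eVariationOn (fun x => (!₂[x, f x] : Plane)) (Set.Icc 0 1) := by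
    calc (1 : ℝ≥0∞) ≤ edist (!₂[1, f 1] : Plane) !₂[0, f 0] := by
          rw [edist_dist, dist_eq_norm, ENNReal.one_le_ofReal]
          simpa using abs_apply_le_norm (!₂[1, f 1] - !₂[0, f 0]) 0
      _ ≤ _ := eVariationOn.edist_le (fun x => (!₂[x, f x] : Plane))
          (Set.right_mem_Icc.2 zero_le_one) (Set.left_mem_Icc.2 zero_le_one)
  obtain ⟨t, ht, hvar⟩ := exists_eVariationOn_Icc_eq hF zero_le_one hlength
  have himage : (fun s : ℝ => t * s) '' Set.Icc 0 1 = Set.Icc 0 t := by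
    rw [Set.image_mul_left_Icc ht.1 zero_le_one, mul_zero, mul_one]
  refine ⟨_, Set.image_mono (Set.Icc_subset_Icc_right ht.2), (fun x => !₂[x, f x]) ∘ (t * ·),
    (hF.continuous.comp (continuous_const_mul t)).continuousOn, ?_, ?_⟩
  · rw [eVariationOn.comp_eq_of_monotoneOn _ _
      ((monotone_mul_left_of_nonneg ht.1).monotoneOn _), himage, hvar]
  · rw [Set.image_comp, himage]

end Rectifiability

theorem exists_le_modulus {p : ℝ} (hp : 3 < p) :
    ∃ c : ℝ≥0, 0 < c ∧ ∀ Γ : Set (Set Plane),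
      (∀ f : ℝ → ℝ, LipschitzWith 1 f → (∀ x, f x ∈ Set.Icc 0 1) →
        ∃ γ ⊆ graphOverUnitInterval f, IsLocallyRectifiableCurve γ ∧ ContainsIsometricCopy Γ γ) →
      c ≤ modulus p Γ := by
  obtain ⟨c, hc, hsmall⟩ := exists_graph_lintegral_le_of_pos hp (ε := 1 / 4) (by positivity)
  refine ⟨c, hc, fun Γ hΓ => le_iInf₂ fun ρ ⟨hρ, hρΓ⟩ => ?_⟩
  by_contra! hlt
  obtain ⟨f, hf, hf_mem, hfρ⟩ := hsmall ρ hρ hlt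
  obtain ⟨γ, hγf, hγ, ι, hι⟩ := hΓ f hf hf_mem
  refine (hρΓ _ hι (hγ.image ι.isometry.lipschitz)).not_gt ?_
  have hF := ι.isometry.lipschitz.comp (lipschitzWith_graph hf)
  calc ∫⁻ x in ι '' γ, ρ x ∂Measure.hausdorffMeasure 1
      ≤ ∫⁻ x in (ι ∘ fun x => !₂[x, f x]) '' Set.Icc 0 1, ρ x ∂Measure.hausdorffMeasure 1 := by
        rw [Set.image_comp]
        exact lintegral_mono_set (Set.image_mono hγf)
    _ ≤ (1 * 2 : ℝ≥0) * ∫⁻ x in Set.Icc 0 1, ρ (ι !₂[x, f x]) :=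
        setLIntegral_hausdorffMeasure_image_le hF _ hρ
    _ ≤ (1 * 2 : ℝ≥0) * (1 / 4 : ℝ≥0) := by
        rw [setLIntegral_congr Ioc_ae_eq_Icc.symm]
        gcongr
        exact hfρ ι
    _ < 1 := by
        norm_cast
        rw [← NNReal.coe_lt_coe]
        norm_num

theorem theorem1 (p : ℝ) (hp : 3 < p) :
    ∃ c : ℝ≥0, 0 < c ∧
      (∀ Γ : Set (Set Plane), (∀ γ ∈ Γ, IsCurve γ) →
        (∀ f : ℝ → ℝ, Set.MapsTo f (Set.Icc 0 1) (Set.Icc 0 1) →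
          LipschitzOnWith 1 f (Set.Icc 0 1) →
          ContainsIsometricCopy Γ (graphOverUnitInterval f)) →
        (c : ℝ≥0∞) ≤ modulus p Γ) ∧
      (∀ Γ : Set (Set Plane), IsMoserFamily Γ → (c : ℝ≥0∞) ≤ modulus p Γ) := by
  obtain ⟨c, hc, hmodulus⟩ := exists_le_modulus hp
  refine ⟨c, hc, fun Γ _ hΓ => hmodulus Γ fun f hf hf_mem => ?_,
    fun Γ hΓ => hmodulus Γ fun f hf _ => ?_⟩
  · exact ⟨_, subset_rfl, isLocallyRectifiableCurve_graph hf,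
      hΓ f (fun x _ => hf_mem x) hf.lipschitzOnWith⟩
  · obtain ⟨γ, hγf, hγ⟩ := exists_isCurveOfLengthOne_subset_graph hf
    exact ⟨γ, hγf, hγ.isLocallyRectifiableCurve, hΓ.2 γ hγ⟩
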